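/- Let $A\in\mathbb{R}^{n\times n}$ and $B\in\mathbb{R}^{n\times m}$ with $(A,B)$ stabilizable (i.e. $A+BF$ has all its eigenvalues in the open left half plane for some real matrix $F$). A weighted directed graph on the nodes $\{1,\dots,N\}$ is given by weights $a_{ij}\ge 0$ with $a_{ii}=0$. Consider $N$ identical agents $\dot x_i=Ax_i+Bu_i$, $i=1,\dots,N$, in which agent $i$ receives the network signal $\zeta_i=\sum_{j=1}^N a_{ij}(x_i-x_j)$. A protocol $\dot\xi_i=f(\xi_i,\zeta_i)$, $u_i=g(\xi_i,\zeta_i)$, with $\xi_i$ in some $\mathbb{R}^q$, achieves network stability if, for all initial conditions $x_i(0)$, $\xi_i(0)$, the closed loop has a solution on $[0,\infty)$ and along every such solution $\zeta_i(t)\to 0$ as $t\to\infty$ for all $i$. Then: (1) Scale-free weak state synchronization is solvable: there is a single protocol $(f,g)$, depending only on $(A,B)$, that achieves network stability for every number of agents $N$ and every weighted directed graph on $N$ nodes (no connectivity or spanning-tree assumption). (2) The Riccati equation $A^{T}P+PA-PBB^{T}P+I=0$ has a symmetric positive definite solution $P$, and for each such $P$ the adaptive protocol $$\dot\rho_i=\zeta_i^{T}PBB^{T}P\zeta_i,\qquad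 u_i=-\rho_iB^{T}P\zeta_i,$$ with scalar internal state $\rho_i$ and arbitrary real initial value $\rho_i(0)$, achieves network stability for every $N$ and every weighted directed graph on $N$ nodes. -/

import Mathlib

open Filter Topology
open scoped Matrix

/-- A real square matrix is Hurwitz if all its complex eigenvalues have negative real part. -/
def IsHurwitz {n : ℕ} (M : Matrix (Fin n) (Fin n) ℝ) : Prop :=
  ∀ z ∈ spectrum ℂ (M.map Complex.ofReal), z.re < 0

/-- The pair `(A, B)` is stabilizable: some linear state feedback makes `A + B F` Hurwitz. -/
def Stabilizable {n m : ℕ} (A : Matrix (Fin n) (Fin n) ℝ) (B : Matrix (Fin n) (Fin m) ℝ) : Prop :=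
  ∃ F : Matrix (Fin m) (Fin n) ℝ, IsHurwitz (A + B * F)

/-- A directed weighted graph with nodes `Fin N`, given by its weighted adjacency matrix
(`adj i j > 0` means that there is an edge from `j` to `i`); no self-loops. -/
structure WeightedGraph (N : ℕ) where
  adj : Matrix (Fin N) (Fin N) ℝ
  adj_nonneg : ∀ i j, 0 ≤ adj i j
  adj_self : ∀ i, adj i i = 0

/-- The network signal `ζ_i = ∑ j, a_ij (x_i - x_j)`. -/
def WeightedGraph.zeta {N n : ℕ} (G : WeightedGraph N) (x : Fin N → Fin n → ℝ) (i : Fin N) :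
    Fin n → ℝ :=
  ∑ j, G.adj i j • (x i - x j)

/-- A fully distributed protocol `ξ_i' = f(ξ_i, ζ_i)`, `u_i = g(ξ_i, ζ_i)` with finite-dimensional
internal state, the same for all agents. -/
structure Protocol (n m : ℕ) where
  dim : ℕ
  f : (Fin dim → ℝ) → (Fin n → ℝ) → (Fin dim → ℝ)
  g : (Fin dim → ℝ) → (Fin n → ℝ) → (Fin m → ℝ)

/-- `(x, ξ)` is a solution on `[0, ∞)` of the network of agents `x_i' = A x_i + B u_i`
communicating over `G` and controlled by the protocol `K`. -/
def IsClosedLoopSolution {n m N : ℕ} (A : Matrix (Fin n) (Fin n) ℝ) (B : Matrix (Fin n) (Fin m) ℝ)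
    (G : WeightedGraph N) (K : Protocol n m)
    (x : Fin N → ℝ → Fin n → ℝ) (ξ : Fin N → ℝ → Fin K.dim → ℝ) : Prop :=
  ∀ i : Fin N, ∀ t : ℝ, 0 ≤ t →
    HasDerivWithinAt (x i)
      (A *ᵥ x i t + B *ᵥ K.g (ξ i t) (G.zeta (fun j => x j t) i)) (Set.Ici 0) t ∧
    HasDerivWithinAt (ξ i) (K.f (ξ i t) (G.zeta (fun j => x j t) i)) (Set.Ici 0) t

/-- The protocol achieves network stability: for all initial conditions of agents and protocols,
the closed loop has a solution on `[0, ∞)`, and along every such solution all the network signals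
converge to zero. -/
def NetworkStability {n m N : ℕ} (A : Matrix (Fin n) (Fin n) ℝ) (B : Matrix (Fin n) (Fin m) ℝ)
    (G : WeightedGraph N) (K : Protocol n m) : Prop :=
  ∀ (x₀ : Fin N → Fin n → ℝ) (ξ₀ : Fin N → Fin K.dim → ℝ),
    (∃ x ξ, IsClosedLoopSolution A B G K x ξ ∧ (∀ i, x i 0 = x₀ i) ∧ (∀ i, ξ i 0 = ξ₀ i)) ∧
    ∀ x ξ, IsClosedLoopSolution A B G K x ξ → (∀ i, x i 0 = x₀ i) → (∀ i, ξ i 0 = ξ₀ i) →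
      ∀ i, Tendsto (fun t => G.zeta (fun j => x j t) i) atTop (𝓝 0)

/-- Scale-free weak state synchronization: one protocol achieves network stability for every
number of agents and every graph. -/
def ScaleFreeWeakSync {n m : ℕ} (A : Matrix (Fin n) (Fin n) ℝ) (B : Matrix (Fin n) (Fin m) ℝ)
    (K : Protocol n m) : Prop :=
  ∀ (N : ℕ) (G : WeightedGraph N), NetworkStability A B G K

/-- `P` is a positive definite (symmetric) solution of `AᵀP + PA - PBBᵀP + I = 0`. -/
def IsRiccatiSolution {n m : ℕ} (A : Matrix (Fin n) (Fin n) ℝ) (B : Matrix (Fin n) (Fin m) ℝ)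
    (P : Matrix (Fin n) (Fin n) ℝ) : Prop :=
  P.PosDef ∧ Aᵀ * P + P * A - P * B * Bᵀ * P + 1 = 0

/-- The adaptive protocol `ρ_i' = ζ_iᵀ P B Bᵀ P ζ_i`, `u_i = -ρ_i Bᵀ P ζ_i`, whose internal state
is the scalar `ρ_i`. -/
def adaptiveProtocol {n m : ℕ} (B : Matrix (Fin n) (Fin m) ℝ) (P : Matrix (Fin n) (Fin n) ℝ) :
    Protocol n m where
  dim := 1
  f := fun _ ζ => fun _ => ζ ⬝ᵥ ((P * B * Bᵀ * P) *ᵥ ζ)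
  g := fun ρ ζ => -(ρ 0 • ((Bᵀ * P) *ᵥ ζ))

/-! Write y_i = BᵀPζ_i, so that ρ_i' = |y_i|² and each gain is nondecreasing. Everything reduces to
bounding the gains. If they are bounded, all y_i are square integrable, and ζ_i' = Aζ_i + Bu_i with
u_i a bounded combination of the y_j. By the Riccati equation ζᵀPζ then decays exponentially up to
an integrable input, so ζ_i → 0 (`IsAdaptiveSolution.tendsto_zeta`).

Boundedness (`IsAdaptiveSolution.bddAbove`) is by contradiction. Let S be the set of agents with
unbounded gain and T a minimal nonempty part of S that is closed under in-neighbours within S. Then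
T is strongly connected and hears only itself and agents outside S, whose y_o are square integrable.
With α the positive left null vector of the Laplacian of T, consider V = ∑ (α_i/ρ_i) e_iᵀPe_i. The
weight 1/ρ_i cancels the gain in the feedback term and leaves a Laplacian form in BᵀPe_i, which is
coercive; once the gains are large this form dominates the Riccati term. Hence V plus a multiple of
∑ ρ_i is controlled by the integrable input, which bounds the gains in T
(`IsRiccatiSolution.exists_gain_bound`). The error e is x minus the position the outside agents
dictate, or, if T hears nobody else, x minus its (α_i/ρ_i)-weighted mean.

The argument also applies on bounded time intervals. There it makes the state equation linearly
bounded, so Gronwall excludes finite escape and solutions are global.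

A Riccati solution comes from policy iteration (Newton–Kleinman): starting from a stabilizing
feedback, the cost matrices decrease and their limit solves the equation. The Lyapunov equations on
the way are solved by algebra and compactness, without matrix exponentials. -/

/-! ### Lyapunov equations, policy iteration and the Riccati equation. -/

section Lyapunov

variable {n m : ℕ}

-- Gelfand's formula: a spectral radius below 1 forces some power to have Euclidean operator norm
-- below 1. The norm is taken over ℂ, where real vectors keep their length.
open scoped Matrix.Norms.L2Operator in
theorem exists_pow_mulVec_lt (C : Matrix (Fin n) (Fin n) ℝ)
    (hC : ∀ z ∈ spectrum ℂ (C.map Complex.ofReal), ‖z‖ < 1) :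
    ∃ k : ℕ, k ≠ 0 ∧ ∀ v : Fin n → ℝ, v ≠ 0 → (C ^ k *ᵥ v) ⬝ᵥ (C ^ k *ᵥ v) < v ⬝ᵥ v := by
  rcases Nat.eq_zero_or_pos n with rfl | hn
  · exact ⟨1, one_ne_zero, fun v hv => absurd (Subsingleton.elim v 0) hv⟩
  have : Nonempty (Fin n) := ⟨⟨0, hn⟩⟩
  set D := C.map Complex.ofReal with hD
  have hrad : spectralRadius ℂ D < (1 : NNReal) :=
    spectrum.spectralRadius_lt_of_forall_lt D (fun z hz => by exact_mod_cast hC z hz)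
  have hlim := spectrum.pow_norm_pow_one_div_tendsto_nhds_spectralRadius D
  have hev := hlim.eventually (eventually_lt_nhds hrad)
  obtain ⟨k, hk, hk0⟩ := (hev.and (eventually_gt_atTop 0)).exists
  have hk1 : ‖D ^ k‖ < 1 := by
    by_contra hge
    push Not at hge
    have : (1 : ℝ) ≤ ‖D ^ k‖ ^ (1 / k : ℝ) := Real.one_le_rpow hge (by positivity)
    have := ENNReal.ofReal_le_ofReal this
    simp only [ENNReal.ofReal_one] at this
    exact absurd hk (not_lt.mpr (by simpa using this))
  have hDk : D ^ k = (C ^ k).map Complex.ofReal := by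
    rw [hD]
    exact (map_pow (Complex.ofRealHom.mapMatrix) C k).symm
  refine ⟨k, hk0.ne', fun v hv => ?_⟩
  have hnorm : ∀ w : Fin n → ℝ,
      ‖(WithLp.toLp 2 (fun i => (w i : ℂ)) : EuclideanSpace ℂ (Fin n))‖ ^ 2 = w ⬝ᵥ w := by
    intro w
    rw [EuclideanSpace.norm_sq_eq]
    simp [dotProduct, sq]
  have hle := Matrix.l2_opNorm_mulVec (D ^ k) (WithLp.toLp 2 (fun i => (v i : ℂ)))
  have hmul : D ^ k *ᵥ (fun i => (v i : ℂ)) = fun i => (((C ^ k *ᵥ v) i : ℝ) : ℂ) := by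
    rw [hDk]
    ext i
    simp [Matrix.mulVec, dotProduct]
  rw [← hnorm, ← hnorm]
  have hvpos : 0 < ‖(WithLp.toLp 2 (fun i => (v i : ℂ)) : EuclideanSpace ℂ (Fin n))‖ := by
    have h : 0 < v ⬝ᵥ v := by
      have := Matrix.dotProduct_star_self_pos_iff.mpr hv
      simpa using this
    rw [← hnorm] at h
    exact lt_of_le_of_ne (norm_nonneg _) (fun h0 => by rw [← h0] at h; simp at h)
  have hlt : ‖(WithLp.toLp 2 (fun i => (((C ^ k *ᵥ v) i : ℝ) : ℂ)) : EuclideanSpace ℂ (Fin n))‖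
      < ‖(WithLp.toLp 2 (fun i => (v i : ℂ)) : EuclideanSpace ℂ (Fin n))‖ := by
    simp only [hmul] at hle
    refine lt_of_le_of_lt hle ?_
    calc _ < 1 * _ := mul_lt_mul_of_pos_right hk1 hvpos
      _ = _ := one_mul _
  gcongr

/-- `S` defines a strict quadratic Lyapunov function for `x' = M x`. -/
structure IsLyapunov (M S : Matrix (Fin n) (Fin n) ℝ) : Prop where
  symm : Sᵀ = S
  pos : ∀ v : Fin n → ℝ, v ≠ 0 → 0 < v ⬝ᵥ (S *ᵥ v)
  neg : ∀ v : Fin n → ℝ, v ≠ 0 → v ⬝ᵥ (S *ᵥ (M *ᵥ v)) < 0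

theorem dotProduct_self_pos {ι : Type*} [Fintype ι] {v : ι → ℝ} (hv : v ≠ 0) : 0 < v ⬝ᵥ v := by
  simpa using Matrix.dotProduct_star_self_pos_iff.mpr hv

theorem dotProduct_self_nonneg' {ι : Type*} [Fintype ι] (v : ι → ℝ) : 0 ≤ v ⬝ᵥ v := by
  simpa using dotProduct_star_self_nonneg v

theorem dotProduct_mulVec_comm {ι : Type*} [Fintype ι] {S : Matrix ι ι ℝ} (hS : Sᵀ = S)
    (u v : ι → ℝ) : u ⬝ᵥ (S *ᵥ v) = v ⬝ᵥ (S *ᵥ u) := by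
  rw [Matrix.dotProduct_mulVec, dotProduct_comm, ← Matrix.mulVec_transpose, hS]

theorem dotProduct_transpose_mulVec {ι κ : Type*} [Fintype ι] [Fintype κ] (M : Matrix ι κ ℝ)
    (u : κ → ℝ) (v : ι → ℝ) : u ⬝ᵥ (Mᵀ *ᵥ v) = (M *ᵥ u) ⬝ᵥ v := by
  rw [Matrix.mulVec_transpose, dotProduct_comm, ← Matrix.dotProduct_mulVec, dotProduct_comm]

/-- A strict quadratic Lyapunov function for the discrete system `x ↦ C x`. -/
theorem exists_stein (C : Matrix (Fin n) (Fin n) ℝ)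
    (hC : ∀ z ∈ spectrum ℂ (C.map Complex.ofReal), ‖z‖ < 1) :
    ∃ S : Matrix (Fin n) (Fin n) ℝ, Sᵀ = S ∧ (∀ v : Fin n → ℝ, v ≠ 0 → 0 < v ⬝ᵥ (S *ᵥ v)) ∧
      ∀ v : Fin n → ℝ, v ≠ 0 → (C *ᵥ v) ⬝ᵥ (S *ᵥ (C *ᵥ v)) < v ⬝ᵥ (S *ᵥ v) := by
  obtain ⟨k, hk0, hk⟩ := exists_pow_mulVec_lt C hC
  have hq : ∀ v : Fin n → ℝ, v ⬝ᵥ ((∑ j ∈ Finset.range k, (C ^ j)ᵀ * C ^ j) *ᵥ v) =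
      ∑ j ∈ Finset.range k, (C ^ j *ᵥ v) ⬝ᵥ (C ^ j *ᵥ v) := by
    intro v
    rw [Matrix.sum_mulVec, dotProduct_sum]
    refine Finset.sum_congr rfl fun j _ => ?_
    rw [← Matrix.mulVec_mulVec, dotProduct_transpose_mulVec]
  -- In ∑_{j<k} |C^j v|², replacing v by Cv trades the term |v|² for |C^k v|², which is smaller.
  refine ⟨∑ j ∈ Finset.range k, (C ^ j)ᵀ * C ^ j, ?_, fun v hv => ?_, fun v hv => ?_⟩
  · simp [Matrix.transpose_sum, Matrix.transpose_mul]
  · rw [hq]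
    have h0 : 0 ∈ Finset.range k := by simpa using Nat.pos_of_ne_zero hk0
    refine lt_of_lt_of_le (dotProduct_self_pos hv) ?_
    have := Finset.single_le_sum (f := fun j => (C ^ j *ᵥ v) ⬝ᵥ (C ^ j *ᵥ v))
      (fun j _ => dotProduct_self_nonneg' _) h0
    simpa using this
  · rw [hq, hq]
    have h1 := Finset.sum_range_succ (fun j => (C ^ j *ᵥ v) ⬝ᵥ (C ^ j *ᵥ v)) k
    have h2 := Finset.sum_range_succ' (fun j => (C ^ j *ᵥ v) ⬝ᵥ (C ^ j *ᵥ v)) k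
    have h3 := hk v hv
    simp only [Matrix.mulVec_mulVec, ← pow_succ, pow_zero, Matrix.one_mulVec] at *
    linarith

/-- The Cayley transform (1 + M)(1 - M)⁻¹ carries the left half plane into the unit disc, so a
discrete Lyapunov matrix S exists for it. At w = (1 - M)v its decrease reads |(1 + M)v|² < |(1 -
M)v|² in the S-norm, that is 4 vᵀSMv < 0. -/
theorem IsHurwitz.exists_isLyapunov {M : Matrix (Fin n) (Fin n) ℝ} (hM : IsHurwitz M) :
    ∃ S, IsLyapunov M S := by
  set D := M.map Complex.ofReal with hD
  have hunit : ∀ z : ℂ, 0 ≤ z.re → IsUnit (algebraMap ℂ (Matrix (Fin n) (Fin n) ℂ) z - D) := by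
    intro z hz
    by_contra h
    exact absurd (hM z (spectrum.mem_iff.mpr h)) (not_lt.mpr hz)
  have hU : IsUnit (1 - M).det := by
    have h1 := hunit 1 (by simp)
    rw [Matrix.isUnit_iff_isUnit_det] at h1
    have h2 : (algebraMap ℂ (Matrix (Fin n) (Fin n) ℂ) 1 - D) =
        (Complex.ofRealHom.mapMatrix (1 - M)) := by
      rw [map_sub, map_one, map_one]; rfl
    rw [h2, ← RingHom.map_det] at h1
    rw [isUnit_iff_ne_zero] at h1 ⊢
    intro h0
    apply h1
    rw [h0, map_zero]
  set R := (1 - M)⁻¹ with hR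
  have hRU : (1 - M) * R = 1 := Matrix.mul_nonsing_inv _ hU
  have hUR : R * (1 - M) = 1 := Matrix.nonsing_inv_mul _ hU
  have hspec : ∀ z ∈ spectrum ℂ (((1 + M) * R).map Complex.ofReal), ‖z‖ < 1 := by
    intro z hz
    by_contra hge
    push Not at hge
    apply hz
    rw [spectrum.mem_resolventSet_iff]
    set E := Complex.ofRealHom.mapMatrix R with hE
    have hRU' : (1 - D) * E = 1 := by
      have := congrArg Complex.ofRealHom.mapMatrix hRU
      rw [map_mul, map_sub, map_one] at this
      exact this
    have hUR' : E * (1 - D) = 1 := by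
      have := congrArg Complex.ofRealHom.mapMatrix hUR
      rw [map_mul, map_sub, map_one] at this
      exact this
    have hC : ((1 + M) * R).map Complex.ofReal = (1 + D) * E := by
      change Complex.ofRealHom.mapMatrix ((1 + M) * R) = _
      rw [map_mul, map_add, map_one]; rfl
    have hEu : IsUnit E := ⟨⟨E, 1 - D, hUR', hRU'⟩, rfl⟩
    have key : algebraMap ℂ (Matrix (Fin n) (Fin n) ℂ) z - ((1 + M) * R).map Complex.ofReal =
        ((z - 1) • (1 : Matrix (Fin n) (Fin n) ℂ) - (z + 1) • D) * E := by
      rw [hC, Algebra.algebraMap_eq_smul_one]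
      nth_rewrite 1 [← hRU']
      simp only [sub_mul, add_mul, smul_sub, sub_smul, add_smul, one_smul, Matrix.smul_mul,
        one_mul]
      abel
    rw [key]
    refine IsUnit.mul ?_ hEu
    by_cases hz1 : z + 1 = 0
    · rw [hz1, zero_smul, sub_zero]
      have : z - 1 ≠ 0 := by
        have : z = -1 := by linear_combination hz1
        rw [this]; norm_num
      exact ((Units.mk0 _ this) • (1 : (Matrix (Fin n) (Fin n) ℂ)ˣ)).isUnit
    · have h1 : (z - 1) • (1 : Matrix (Fin n) (Fin n) ℂ) - (z + 1) • D =
          (z + 1) • (algebraMap ℂ (Matrix (Fin n) (Fin n) ℂ) ((z - 1) / (z + 1)) - D) := by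
        rw [Algebra.algebraMap_eq_smul_one, smul_sub, smul_smul, mul_div_cancel₀ _ hz1]
      rw [h1]
      -- The real part equals (|z|² - 1)/|z + 1|².
      have h2 : 0 ≤ ((z - 1) / (z + 1)).re := by
        rw [Complex.div_re]
        have h3 : 1 ≤ Complex.normSq z := by
          rw [Complex.normSq_eq_norm_sq]; nlinarith
        rw [Complex.normSq_apply] at h3
        have h4 := Complex.normSq_nonneg (z + 1)
        rw [← add_div]
        apply div_nonneg _ h4
        simp
        nlinarith
      obtain ⟨u, hu⟩ := hunit _ h2
      rw [← hu]
      exact ((Units.mk0 _ hz1) • u).isUnit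
  obtain ⟨S, hS, hpos, hlt⟩ := exists_stein _ hspec
  refine ⟨S, hS, hpos, fun v hv => ?_⟩
  have hw : (1 - M) *ᵥ v ≠ 0 := by
    intro h0
    apply hv
    have := congrArg (R *ᵥ ·) h0
    simpa [Matrix.mulVec_mulVec, hUR] using this
  have h := hlt _ hw
  rw [Matrix.mulVec_mulVec, Matrix.mul_assoc, hUR, Matrix.mul_one] at h
  simp only [Matrix.add_mulVec, Matrix.sub_mulVec, Matrix.one_mulVec, Matrix.mulVec_add,
    Matrix.mulVec_sub, dotProduct_add, add_dotProduct, sub_dotProduct, dotProduct_sub] at h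
  have hc := dotProduct_mulVec_comm hS (M *ᵥ v) v
  linarith

/-- The generalized Rayleigh quotient is homogeneous of degree 0, so its minimum over the compact
unit sphere is a global one. -/
theorem exists_min_rayleigh {ι : Type*} [Fintype ι] [Nonempty ι] (X : Matrix ι ι ℝ)
    {S : Matrix ι ι ℝ} (hS : ∀ v : ι → ℝ, v ≠ 0 → 0 < v ⬝ᵥ (S *ᵥ v)) :
    ∃ c : ℝ, ∃ w : ι → ℝ, w ≠ 0 ∧ w ⬝ᵥ (X *ᵥ w) = c * (w ⬝ᵥ (S *ᵥ w)) ∧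
      ∀ v : ι → ℝ, c * (v ⬝ᵥ (S *ᵥ v)) ≤ v ⬝ᵥ (X *ᵥ v) := by
  have hne : ∀ v ∈ Metric.sphere (0 : ι → ℝ) 1, v ≠ 0 := by
    rintro v hv rfl
    simp at hv
  have hcont : ContinuousOn (fun v : ι → ℝ => (v ⬝ᵥ (X *ᵥ v)) / (v ⬝ᵥ (S *ᵥ v)))
      (Metric.sphere (0 : ι → ℝ) 1) := by
    refine ContinuousOn.div ?_ ?_ (fun v hv => (hS v (hne v hv)).ne')
    · exact (Continuous.dotProduct continuous_id
        (Continuous.matrix_mulVec continuous_const continuous_id)).continuousOn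
    · exact (Continuous.dotProduct continuous_id
        (Continuous.matrix_mulVec continuous_const continuous_id)).continuousOn
  obtain ⟨w, hw, hmin⟩ := (isCompact_sphere (0 : ι → ℝ) 1).exists_isMinOn
    (NormedSpace.sphere_nonempty.mpr zero_le_one) hcont
  refine ⟨_, w, hne w hw, (div_mul_cancel₀ _ (hS w (hne w hw)).ne').symm, fun v => ?_⟩
  rcases eq_or_ne v 0 with rfl | hv
  · simp
  have hv' : (‖v‖⁻¹ • v) ∈ Metric.sphere (0 : ι → ℝ) 1 := by
    simp [norm_smul, inv_mul_cancel₀ (norm_ne_zero_iff.mpr hv)]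
  have h := hmin hv'
  simp only [Set.mem_ofPred_eq, Matrix.mulVec_smul, dotProduct_smul, smul_dotProduct, smul_eq_mul] at h
  have hn : ‖v‖⁻¹ ≠ 0 := inv_ne_zero (norm_ne_zero_iff.mpr hv)
  rw [mul_div_mul_left _ _ hn, mul_div_mul_left _ _ hn] at h
  rwa [le_div_iff₀ (hS v hv)] at h

/-- Replaces the formula X = ∫ exp(tMᵀ) Q exp(tM) dt. A minimizer w of the quotient of X by S is a
generalized eigenvector, Xw = cSw, and testing the equation on w gives -wᵀQw = 2c wᵀSMw; since wᵀSMw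
< 0, c cannot be negative. -/
theorem IsLyapunov.nonneg_of_lyapunovEq {M S X Q : Matrix (Fin n) (Fin n) ℝ} (h : IsLyapunov M S)
    (hX : Xᵀ = X) (hQ : ∀ v, 0 ≤ v ⬝ᵥ (Q *ᵥ v)) (heq : Mᵀ * X + X * M = -Q) (v : Fin n → ℝ) :
    0 ≤ v ⬝ᵥ (X *ᵥ v) := by
  rcases Nat.eq_zero_or_pos n with rfl | hn
  · simp [Subsingleton.elim v 0]
  have : Nonempty (Fin n) := ⟨⟨0, hn⟩⟩
  obtain ⟨c, w, hw, hwc, hmin⟩ := exists_min_rayleigh X h.pos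
  suffices hc : 0 ≤ c by
    rcases eq_or_ne v 0 with rfl | hv
    · simp
    · exact (mul_nonneg hc (h.pos v hv).le).trans (hmin v)
  have hpsd : (X - c • S).PosSemidef := by
    refine Matrix.PosSemidef.of_dotProduct_mulVec_nonneg ?_ fun u => ?_
    · rw [Matrix.IsHermitian, Matrix.conjTranspose_eq_transpose_of_trivial, Matrix.transpose_sub,
      Matrix.transpose_smul, hX, h.symm]
    · simpa [Matrix.sub_mulVec, Matrix.smul_mulVec, dotProduct_sub] using hmin u
  have hz : (X - c • S) *ᵥ w = 0 := by
    rw [← hpsd.dotProduct_mulVec_zero_iff]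
    simp [Matrix.sub_mulVec, Matrix.smul_mulVec, dotProduct_sub, hwc]
  have hz' : X *ᵥ w = c • (S *ᵥ w) := by
    simpa [Matrix.sub_mulVec, Matrix.smul_mulVec, sub_eq_zero] using hz
  have h1 : w ⬝ᵥ ((Mᵀ * X + X * M) *ᵥ w) = 2 * c * (w ⬝ᵥ (S *ᵥ (M *ᵥ w))) := by
    rw [Matrix.add_mulVec, dotProduct_add, ← Matrix.mulVec_mulVec, ← Matrix.mulVec_mulVec,
      dotProduct_transpose_mulVec, dotProduct_mulVec_comm hX w (M *ᵥ w), hz', dotProduct_smul,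
      dotProduct_mulVec_comm h.symm (M *ᵥ w) w, smul_eq_mul]
    ring
  rw [heq, Matrix.neg_mulVec, dotProduct_neg] at h1
  have h2 := hQ w
  have h3 := h.neg w hw
  nlinarith

theorem eq_zero_of_quadratic_eq_zero {X : Matrix (Fin n) (Fin n) ℝ} (hX : Xᵀ = X)
    (h : ∀ v : Fin n → ℝ, v ⬝ᵥ (X *ᵥ v) = 0) : X = 0 := by
  have hpsd : X.PosSemidef := by
    refine Matrix.PosSemidef.of_dotProduct_mulVec_nonneg ?_ fun u => ?_
    · rw [Matrix.IsHermitian, Matrix.conjTranspose_eq_transpose_of_trivial]; exact hX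
    · simp [h u]
  refine Matrix.ext_of_mulVec_single fun i => ?_
  rw [Matrix.zero_mulVec, ← hpsd.dotProduct_mulVec_zero_iff]
  simpa using h (Pi.single i 1)

/-- The Lyapunov equation is solvable in symmetric matrices. -/
theorem IsLyapunov.exists_lyapunovEq {M S Q : Matrix (Fin n) (Fin n) ℝ} (h : IsLyapunov M S)
    (hQ : Qᵀ = Q) : ∃ X : Matrix (Fin n) (Fin n) ℝ, Xᵀ = X ∧ Mᵀ * X + X * M = -Q := by
  let V : Submodule ℝ (Matrix (Fin n) (Fin n) ℝ) :=
    { carrier := {X | Xᵀ = X}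
      add_mem' := fun {a b} ha hb => by
        simp only [Set.mem_ofPred_eq] at *; rw [Matrix.transpose_add, ha, hb]
      zero_mem' := by simp
      smul_mem' := fun c a ha => by
        simp only [Set.mem_ofPred_eq] at *; rw [Matrix.transpose_smul, ha] }
  let T : Matrix (Fin n) (Fin n) ℝ →ₗ[ℝ] Matrix (Fin n) (Fin n) ℝ :=
    LinearMap.mulLeft ℝ Mᵀ + LinearMap.mulRight ℝ M
  have hTV : ∀ X ∈ V, T X ∈ V := by
    intro X hX
    change (Mᵀ * X + X * M)ᵀ = Mᵀ * X + X * M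
    have hX' : Xᵀ = X := hX
    rw [Matrix.transpose_add, Matrix.transpose_mul, Matrix.transpose_mul, hX',
      Matrix.transpose_transpose, add_comm]
  -- For a solution X of the homogeneous equation both X and -X are nonnegative, hence X = 0; in
  -- finite dimension injectivity gives surjectivity.
  have hinj : Function.Injective (T.restrict hTV) := by
    rw [← LinearMap.ker_eq_bot, LinearMap.ker_eq_bot']
    rintro ⟨X, hX⟩ h0
    have hX' : Xᵀ = X := hX
    have h1 : Mᵀ * X + X * M = 0 := congrArg Subtype.val h0
    have hpos := h.nonneg_of_lyapunovEq hX' (Q := 0) (by simp) (by simp [h1])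
    have hneg := h.nonneg_of_lyapunovEq (X := -X) (Q := 0) (by simp [hX']) (by simp)
      (by simp only [Matrix.mul_neg, Matrix.neg_mul, ← neg_add, h1, neg_zero])
    ext1
    refine eq_zero_of_quadratic_eq_zero hX' fun v => ?_
    have h2 := hpos v
    have h3 := hneg v
    rw [Matrix.neg_mulVec, dotProduct_neg] at h3
    linarith
  obtain ⟨⟨X, hX⟩, hXQ⟩ := (LinearMap.injective_iff_surjective.mp hinj)
    ⟨-Q, by change (-Q)ᵀ = -Q; rw [Matrix.transpose_neg, hQ]⟩
  exact ⟨X, hX, congrArg Subtype.val hXQ⟩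

/-- `P` is the cost of the stabilizing feedback `F` for the quadratic cost `|x|² + |u|²`. -/
structure IsFeedbackCost (A : Matrix (Fin n) (Fin n) ℝ) (B : Matrix (Fin n) (Fin m) ℝ)
    (F : Matrix (Fin m) (Fin n) ℝ) (P : Matrix (Fin n) (Fin n) ℝ) : Prop where
  symm : Pᵀ = P
  nonneg : ∀ v : Fin n → ℝ, 0 ≤ v ⬝ᵥ (P *ᵥ v)
  eq : (A + B * F)ᵀ * P + P * (A + B * F) = -(1 + Fᵀ * F)

theorem one_add_gram_quadratic (F : Matrix (Fin m) (Fin n) ℝ) (v : Fin n → ℝ) :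
    v ⬝ᵥ ((1 + Fᵀ * F) *ᵥ v) = v ⬝ᵥ v + (F *ᵥ v) ⬝ᵥ (F *ᵥ v) := by
  rw [Matrix.add_mulVec, dotProduct_add, ← Matrix.mulVec_mulVec, dotProduct_transpose_mulVec,
    Matrix.one_mulVec]

theorem IsLyapunov.exists_isFeedbackCost {A : Matrix (Fin n) (Fin n) ℝ}
    {B : Matrix (Fin n) (Fin m) ℝ} {F : Matrix (Fin m) (Fin n) ℝ} {S : Matrix (Fin n) (Fin n) ℝ}
    (h : IsLyapunov (A + B * F) S) : ∃ P, IsFeedbackCost A B F P := by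
  obtain ⟨P, hP, heq⟩ := h.exists_lyapunovEq (Q := 1 + Fᵀ * F)
    (by rw [Matrix.transpose_add, Matrix.transpose_mul, Matrix.transpose_transpose,
      Matrix.transpose_one])
  refine ⟨P, hP, h.nonneg_of_lyapunovEq hP (fun v => ?_) heq, heq⟩
  rw [one_add_gram_quadratic]
  exact add_nonneg (dotProduct_self_nonneg' _) (dotProduct_self_nonneg' _)

theorem quadratic_lyapunov {M P : Matrix (Fin n) (Fin n) ℝ} (hP : Pᵀ = P) (v : Fin n → ℝ) :
    v ⬝ᵥ ((Mᵀ * P + P * M) *ᵥ v) = 2 * (v ⬝ᵥ (P *ᵥ (M *ᵥ v))) := by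
  rw [Matrix.add_mulVec, dotProduct_add, ← Matrix.mulVec_mulVec, ← Matrix.mulVec_mulVec,
    dotProduct_transpose_mulVec, dotProduct_mulVec_comm hP (M *ᵥ v) v]
  ring

/-- On a null vector v of P the cost equation would read |v|² + |Fv|² = 0. -/
theorem IsFeedbackCost.pos {A : Matrix (Fin n) (Fin n) ℝ} {B : Matrix (Fin n) (Fin m) ℝ}
    {F : Matrix (Fin m) (Fin n) ℝ} {P : Matrix (Fin n) (Fin n) ℝ} (h : IsFeedbackCost A B F P)
    {v : Fin n → ℝ} (hv : v ≠ 0) : 0 < v ⬝ᵥ (P *ᵥ v) := by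
  refine lt_of_le_of_ne (h.nonneg v) fun h0 => ?_
  have hpsd : P.PosSemidef := by
    refine Matrix.PosSemidef.of_dotProduct_mulVec_nonneg ?_ fun u => ?_
    · rw [Matrix.IsHermitian, Matrix.conjTranspose_eq_transpose_of_trivial]; exact h.symm
    · simpa using h.nonneg u
  have hz : P *ᵥ v = 0 := by
    rw [← hpsd.dotProduct_mulVec_zero_iff]
    simpa using h0.symm
  have h1 := quadratic_lyapunov (M := A + B * F) h.symm v
  rw [h.eq, Matrix.neg_mulVec, dotProduct_neg, one_add_gram_quadratic,
    dotProduct_mulVec_comm h.symm, hz, dotProduct_zero] at h1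
  have h2 := dotProduct_self_pos hv
  have h3 := dotProduct_self_nonneg' (F *ᵥ v)
  linarith

/-- Completing the square in F. The extra term makes P a Lyapunov matrix for the improved loop and
measures how much the cost drops. -/
theorem IsFeedbackCost.improved_eq {A : Matrix (Fin n) (Fin n) ℝ} {B : Matrix (Fin n) (Fin m) ℝ}
    {F : Matrix (Fin m) (Fin n) ℝ} {P : Matrix (Fin n) (Fin n) ℝ} (h : IsFeedbackCost A B F P) :
    (A + B * -(Bᵀ * P))ᵀ * P + P * (A + B * -(Bᵀ * P)) =
      -(1 + (-(Bᵀ * P))ᵀ * -(Bᵀ * P) + (-(Bᵀ * P) - F)ᵀ * (-(Bᵀ * P) - F)) := by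
  have h1 := h.eq
  simp only [Matrix.transpose_add, Matrix.transpose_mul, Matrix.transpose_neg,
    Matrix.transpose_sub, Matrix.transpose_transpose, h.symm, Matrix.mul_assoc, Matrix.mul_add,
    Matrix.add_mul, Matrix.neg_mul, Matrix.mul_neg, Matrix.sub_mul, Matrix.mul_sub] at h1 ⊢
  rw [← sub_eq_zero] at h1 ⊢
  refine Eq.trans ?_ h1
  abel

/-- One step of policy iteration: the improved feedback `-BᵀP` has a smaller cost. -/
theorem IsFeedbackCost.improve {A : Matrix (Fin n) (Fin n) ℝ} {B : Matrix (Fin n) (Fin m) ℝ}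
    {F : Matrix (Fin m) (Fin n) ℝ} {P : Matrix (Fin n) (Fin n) ℝ} (h : IsFeedbackCost A B F P) :
    ∃ P', IsFeedbackCost A B (-(Bᵀ * P)) P' ∧
      ∀ v : Fin n → ℝ, v ⬝ᵥ (P' *ᵥ v) ≤ v ⬝ᵥ (P *ᵥ v) := by
  have himp := h.improved_eq
  have hL : IsLyapunov (A + B * -(Bᵀ * P)) P := by
    refine ⟨h.symm, fun v hv => h.pos hv, fun v hv => ?_⟩
    have h1 := quadratic_lyapunov (M := A + B * -(Bᵀ * P)) h.symm v
    rw [himp, Matrix.neg_mulVec, dotProduct_neg, Matrix.add_mulVec, dotProduct_add,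
      one_add_gram_quadratic, ← Matrix.mulVec_mulVec, dotProduct_transpose_mulVec] at h1
    have h2 := dotProduct_self_pos hv
    have h3 := dotProduct_self_nonneg' (-(Bᵀ * P) *ᵥ v)
    have h4 := dotProduct_self_nonneg' ((-(Bᵀ * P) - F) *ᵥ v)
    linarith
  obtain ⟨P', hP'⟩ := hL.exists_isFeedbackCost
  refine ⟨P', hP', fun v => ?_⟩
  -- Subtracting the two cost equations for the improved feedback leaves only the completed square
  -- as right-hand side.
  have hd := hL.nonneg_of_lyapunovEq (X := P - P') (Q := (-(Bᵀ * P) - F)ᵀ * (-(Bᵀ * P) - F))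
    (by rw [Matrix.transpose_sub, h.symm, hP'.symm]) (fun u => ?_) ?_ v
  · rw [Matrix.sub_mulVec, dotProduct_sub] at hd
    linarith
  · rw [← Matrix.mulVec_mulVec, dotProduct_transpose_mulVec]
    exact dotProduct_self_nonneg' _
  · have h1 := hP'.eq
    rw [mul_sub, sub_mul]
    rw [← sub_eq_zero] at h1 himp ⊢
    refine Eq.trans ?_ ((congrArg₂ (· - ·) himp h1).trans (sub_zero 0))
    abel

/-- A sequence of symmetric matrices with convergent quadratic forms converges. -/
theorem tendsto_of_quadratic {P : ℕ → Matrix (Fin n) (Fin n) ℝ} (hP : ∀ k, (P k)ᵀ = P k)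
    (h : ∀ v : Fin n → ℝ, ∃ l, Tendsto (fun k => v ⬝ᵥ (P k *ᵥ v)) atTop (𝓝 l)) :
    ∃ L, Tendsto P atTop (𝓝 L) := by
  choose l hl using h
  refine ⟨Matrix.of fun i j => (l (Pi.single i 1 + Pi.single j 1) - l (Pi.single i 1) -
    l (Pi.single j 1)) / 2, ?_⟩
  refine tendsto_pi_nhds.mpr fun i => tendsto_pi_nhds.mpr fun j => ?_
  have h1 := (((hl (Pi.single i 1 + Pi.single j 1)).sub (hl (Pi.single i 1))).sub
    (hl (Pi.single j 1))).div_const 2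
  refine h1.congr fun k => ?_
  have h2 : P k j i = P k i j := by
    conv_lhs => rw [← hP k]
    rfl
  simp only [Matrix.mulVec_add, dotProduct_add, add_dotProduct, Matrix.mulVec_single,
    single_dotProduct]
  simp [h2]
  ring

theorem Stabilizable.exists_isRiccatiSolution {A : Matrix (Fin n) (Fin n) ℝ}
    {B : Matrix (Fin n) (Fin m) ℝ} (hAB : Stabilizable A B) : ∃ P, IsRiccatiSolution A B P := by
  obtain ⟨F₀, hF₀⟩ := hAB
  obtain ⟨S, hS⟩ := hF₀.exists_isLyapunov
  obtain ⟨P₀, hP₀⟩ := hS.exists_isFeedbackCost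
  -- The improved feedback -BᵀP depends on P alone, so the iteration can be run on cost matrices
  -- without carrying F.
  choose! f hf using fun (P : Matrix (Fin n) (Fin n) ℝ) (h : ∃ F, IsFeedbackCost A B F P) =>
    h.choose_spec.improve
  set P : ℕ → Matrix (Fin n) (Fin n) ℝ := fun k => f^[k] P₀ with hPdef
  have hsucc : ∀ k, P (k + 1) = f (P k) := fun k => Function.iterate_succ_apply' f k P₀
  have hcost : ∀ k, ∃ F, IsFeedbackCost A B F (P k) := by
    intro k
    induction k with
    | zero => exact ⟨F₀, hP₀⟩
    | succ k ih => rw [hsucc]; exact ⟨_, (hf _ ih).1⟩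
  have hsymm : ∀ k, (P k)ᵀ = P k := fun k => (hcost k).choose_spec.symm
  have hnn : ∀ k v, 0 ≤ v ⬝ᵥ (P k *ᵥ v) := fun k => (hcost k).choose_spec.nonneg
  obtain ⟨L, hL⟩ := tendsto_of_quadratic hsymm (fun v => by
    have hanti : Antitone (fun k => v ⬝ᵥ (P k *ᵥ v)) := by
      refine antitone_nat_of_succ_le fun k => ?_
      rw [hsucc]
      exact (hf _ (hcost k)).2 v
    exact ⟨_, tendsto_atTop_ciInf hanti ⟨0, by rintro _ ⟨k, rfl⟩; exact hnn k v⟩⟩)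
  have hL1 : Tendsto (fun k => P (k + 1)) atTop (𝓝 L) := hL.comp (tendsto_add_atTop_nat 1)
  have hLsymm : Lᵀ = L := by
    refine tendsto_nhds_unique ?_ hL
    have : Tendsto (fun k => (P k)ᵀ) atTop (𝓝 Lᵀ) :=
      (Continuous.matrix_transpose continuous_id).continuousAt.tendsto.comp hL
    exact this.congr hsymm
  have heq : Aᵀ * L + L * A - L * B * Bᵀ * L + 1 = 0 := by
    have hk : ∀ k, (A + B * -(Bᵀ * P k))ᵀ * P (k + 1) + P (k + 1) * (A + B * -(Bᵀ * P k)) +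
        (1 + (-(Bᵀ * P k))ᵀ * -(Bᵀ * P k)) = 0 := by
      intro k
      rw [hsucc, (hf _ (hcost k)).1.eq, neg_add_cancel]
    have hcont : Continuous (fun p : Matrix (Fin n) (Fin n) ℝ × Matrix (Fin n) (Fin n) ℝ =>
        (A + B * -(Bᵀ * p.1))ᵀ * p.2 + p.2 * (A + B * -(Bᵀ * p.1)) +
        (1 + (-(Bᵀ * p.1))ᵀ * -(Bᵀ * p.1))) := by
      fun_prop
    have h1 := (hcont.continuousAt (x := (L, L))).tendsto.comp (hL.prodMk_nhds hL1)
    have h2 := tendsto_nhds_unique (h1.congr (fun k => hk k)) tendsto_const_nhds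
    simp only [Matrix.transpose_add, Matrix.transpose_mul, Matrix.transpose_neg,
      Matrix.transpose_transpose, hLsymm, Matrix.mul_assoc, Matrix.mul_add, Matrix.add_mul,
      Matrix.neg_mul, Matrix.mul_neg] at h2 ⊢
    refine Eq.trans ?_ h2
    abel
  have hLnn : ∀ v : Fin n → ℝ, 0 ≤ v ⬝ᵥ (L *ᵥ v) := by
    intro v
    have hc : Continuous (fun M : Matrix (Fin n) (Fin n) ℝ => v ⬝ᵥ (M *ᵥ v)) :=
      Continuous.dotProduct continuous_const
        (Continuous.matrix_mulVec continuous_id continuous_const)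
    exact ge_of_tendsto' (hc.continuousAt.tendsto.comp hL) (fun k => hnn k v)
  -- The limit is the cost of its own feedback; this upgrades semidefiniteness to definiteness.
  have hcostL : IsFeedbackCost A B (-(Bᵀ * L)) L := by
    refine ⟨hLsymm, hLnn, ?_⟩
    simp only [Matrix.transpose_add, Matrix.transpose_mul, Matrix.transpose_neg,
      Matrix.transpose_transpose, hLsymm, Matrix.mul_assoc, Matrix.mul_add, Matrix.add_mul,
      Matrix.neg_mul, Matrix.mul_neg] at heq ⊢
    rw [← sub_eq_zero]
    refine Eq.trans ?_ heq
    abel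
  refine ⟨L, Matrix.PosDef.of_dotProduct_mulVec_pos ?_ fun v hv => ?_, heq⟩
  · rw [Matrix.IsHermitian, Matrix.conjTranspose_eq_transpose_of_trivial]; exact hLsymm
  · simpa using hcostL.pos hv

end Lyapunov

/-! ### Coercivity of Laplacian forms on strongly connected graphs. -/

section Graph

variable {ι : Type*} [Fintype ι]

/-- Every nonempty set of nodes that is closed under in-neighbours is the whole graph. -/
def StronglyConnectedWeights (a : ι → ι → ℝ) : Prop :=
  ∀ U : Set ι, U.Nonempty → (∀ i ∈ U, ∀ j, 0 < a i j → j ∈ U) → U = Set.univ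

/-- A Perron–Frobenius argument. For a left null vector v of the Laplacian the triangle inequality
gives one inequality for |v| at each node; both sides have equal sums, so all are equalities and |v|
is again a null vector. Its support is closed under in-neighbours. -/
theorem StronglyConnectedWeights.exists_pos_left_null [Nonempty ι] {a : ι → ι → ℝ}
    (ha : ∀ i j, 0 ≤ a i j) (hconn : StronglyConnectedWeights a) :
    ∃ α : ι → ℝ, (∀ i, 0 < α i) ∧ ∀ j, ∑ i, α i * a i j = α j * ∑ k, a j k := by
  classical
  set L : Matrix ι ι ℝ := Matrix.diagonal (fun i => ∑ k, a i k) - Matrix.of a with hL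
  have hdet : L.det = 0 := by
    rw [← Matrix.exists_mulVec_eq_zero_iff]
    refine ⟨fun _ => 1, fun h => ?_, ?_⟩
    · obtain ⟨i⟩ := ‹Nonempty ι›
      simpa using congrFun h i
    · ext i
      rw [hL, Matrix.sub_mulVec, Pi.sub_apply, Matrix.mulVec_diagonal]
      simp [Matrix.mulVec, dotProduct]
  obtain ⟨v, hv, hvL⟩ := Matrix.exists_vecMul_eq_zero_iff.mpr hdet
  have hv1 : ∀ j, ∑ i, v i * a i j = v j * ∑ k, a j k := by
    intro j
    have := congrFun hvL j
    rw [hL, Matrix.vecMul_sub, Pi.sub_apply, Matrix.vecMul_diagonal] at this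
    simp only [Matrix.vecMul, dotProduct, Matrix.of_apply, Pi.zero_apply] at this
    linarith
  have hle : ∀ j, |v j| * ∑ k, a j k ≤ ∑ i, |v i| * a i j := by
    intro j
    have h1 : |v j| * ∑ k, a j k = |v j * ∑ k, a j k| := by
      rw [abs_mul, abs_of_nonneg (Finset.sum_nonneg fun k _ => ha j k)]
    rw [h1, ← hv1]
    refine (Finset.abs_sum_le_sum_abs _ _).trans (le_of_eq ?_)
    exact Finset.sum_congr rfl fun i _ => by rw [abs_mul, abs_of_nonneg (ha i j)]
  have hsum : ∑ j, |v j| * ∑ k, a j k = ∑ j, ∑ i, |v i| * a i j := by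
    rw [Finset.sum_comm]
    exact Finset.sum_congr rfl fun i _ => by rw [Finset.mul_sum]
  have heq : ∀ j, |v j| * ∑ k, a j k = ∑ i, |v i| * a i j := fun j =>
    (Finset.sum_eq_sum_iff_of_le (fun j _ => hle j)).mp hsum j (Finset.mem_univ j)
  have huniv : {i | v i ≠ 0} = Set.univ := by
    refine hconn _ ?_ ?_
    · obtain ⟨i, hi⟩ := Function.ne_iff.mp hv
      exact ⟨i, hi⟩
    · intro i hi j hij hj
      have hj' : v j = 0 := hj
      have h0 := heq j
      rw [hj', abs_zero, zero_mul] at h0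
      have h1 := (Finset.sum_eq_zero_iff_of_nonneg
        (fun i _ => mul_nonneg (abs_nonneg (v i)) (ha i j))).mp h0.symm i (Finset.mem_univ i)
      exact (mul_pos (abs_pos.mpr hi) hij).ne' h1
  refine ⟨fun i => |v i|, fun i => ?_, fun j => (heq j).symm⟩
  have : i ∈ {i | v i ≠ 0} := by rw [huniv]; trivial
  exact abs_pos.mpr this

/-- The weights α_i a_ij have equal in- and out-sums at every node, which symmetrizes the form of a
directed graph into a sum of squares. -/
theorem laplacian_form_eq {a : ι → ι → ℝ} {α : ι → ℝ}
    (hα : ∀ j, ∑ i, α i * a i j = α j * ∑ k, a j k) (ε z : ι → ℝ) :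
    ∑ i, α i * z i * (∑ j, a i j * (z i - z j) + ε i * z i) =
      (∑ i, ∑ j, α i * a i j * (z i - z j) ^ 2) / 2 + ∑ i, α i * ε i * z i ^ 2 := by
  have h1 : ∑ i, ∑ j, α i * a i j * z j ^ 2 = ∑ i, ∑ j, α i * a i j * z i ^ 2 := by
    rw [Finset.sum_comm]
    refine Finset.sum_congr rfl fun j _ => ?_
    rw [← Finset.sum_mul, hα, Finset.mul_sum, Finset.sum_mul]
  have h2 : ∑ i, α i * z i * (∑ j, a i j * (z i - z j) + ε i * z i) =
      ∑ i, ∑ j, α i * a i j * (z i * (z i - z j)) + ∑ i, α i * ε i * z i ^ 2 := by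
    rw [← Finset.sum_add_distrib]
    refine Finset.sum_congr rfl fun i _ => ?_
    rw [mul_add, Finset.mul_sum]
    congr 1
    · exact Finset.sum_congr rfl fun j _ => by ring
    · ring
  have h3 : ∑ i, ∑ j, α i * a i j * (z i - z j) ^ 2 =
      2 * ∑ i, ∑ j, α i * a i j * (z i * (z i - z j)) +
        (∑ i, ∑ j, α i * a i j * z j ^ 2 - ∑ i, ∑ j, α i * a i j * z i ^ 2) := by
    simp only [Finset.mul_sum, ← Finset.sum_add_distrib, ← Finset.sum_sub_distrib]
    exact Finset.sum_congr rfl fun i _ => Finset.sum_congr rfl fun j _ => by ring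
  rw [h2, h3, h1]
  ring

/-- The weighted Laplacian form is coercive on vectors without definite sign, uniformly, and on
all vectors if there is some grounding. -/
theorem StronglyConnectedWeights.exists_coercive [Nonempty ι] {a : ι → ι → ℝ}
    (ha : ∀ i j, 0 ≤ a i j) (hconn : StronglyConnectedWeights a) {α : ι → ℝ} (hpos : ∀ i, 0 < α i)
    (hα : ∀ j, ∑ i, α i * a i j = α j * ∑ k, a j k) {ε : ι → ℝ} (hε : ∀ i, 0 ≤ ε i) :
    ∃ c > 0, ∀ z : ι → ℝ,
      ((∃ i, 0 < ε i) ∨ ∃ μ : ι → ℝ, (∀ i, 0 < μ i) ∧ ∑ i, μ i * z i = 0) →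
      c * ∑ i, z i ^ 2 ≤ ∑ i, α i * z i * (∑ j, a i j * (z i - z j) + ε i * z i) := by
  set Q : (ι → ℝ) → ℝ := fun z => ∑ i, α i * z i * (∑ j, a i j * (z i - z j) + ε i * z i) with hQ
  have hQcont : Continuous Q := by fun_prop
  -- The weights μ will vary in time, so c must not depend on them. The hyperplane condition is
  -- therefore relaxed to "not of one strict sign", which is closed and still excludes nonzero
  -- constant vectors.
  set K : Set (ι → ℝ) := Metric.sphere 0 1 ∩
    {z | (∃ i, 0 < ε i) ∨ ((∃ i, z i ≤ 0) ∧ ∃ i, 0 ≤ z i)} with hK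
  have hclosed : IsClosed {z : ι → ℝ | (∃ i, 0 < ε i) ∨ ((∃ i, z i ≤ 0) ∧ ∃ i, 0 ≤ z i)} := by
    by_cases h : ∃ i, 0 < ε i
    · simp [h]
    · simp only [h, false_or]
      have h1 : IsClosed {z : ι → ℝ | ∃ i, z i ≤ 0} := by
        rw [Set.ofPred_exists]
        exact isClosed_iUnion_of_finite fun i => isClosed_le (continuous_apply i) continuous_const
      have h2 : IsClosed {z : ι → ℝ | ∃ i, 0 ≤ z i} := by
        rw [Set.ofPred_exists]
        exact isClosed_iUnion_of_finite fun i => isClosed_le continuous_const (continuous_apply i)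
      exact h1.inter h2
  have hKc : IsCompact K := (isCompact_sphere _ _).inter_right hclosed
  have hKpos : ∀ z ∈ K, 0 < Q z := by
    rintro z ⟨hz1, hz2⟩
    have hz0 : z ≠ 0 := by rintro rfl; simp at hz1
    have hnn1 : ∀ i j, 0 ≤ α i * a i j * (z i - z j) ^ 2 := fun i j =>
      mul_nonneg (mul_nonneg (hpos i).le (ha i j)) (sq_nonneg _)
    have hnn2 : ∀ i, 0 ≤ α i * ε i * z i ^ 2 := fun i =>
      mul_nonneg (mul_nonneg (hpos i).le (hε i)) (sq_nonneg _)
    have hs1 : 0 ≤ ∑ i, ∑ j, α i * a i j * (z i - z j) ^ 2 :=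
      Finset.sum_nonneg fun i _ => Finset.sum_nonneg fun j _ => hnn1 i j
    have hs2 : 0 ≤ ∑ i, α i * ε i * z i ^ 2 := Finset.sum_nonneg fun i _ => hnn2 i
    have hQe : Q z = _ := laplacian_form_eq hα ε z
    refine lt_of_le_of_ne (by rw [hQe]; positivity) fun h0 => hz0 ?_
    rw [hQe] at h0
    have hz3 : ∀ i j, 0 < a i j → z i = z j := by
      intro i j hij
      have h1 : ∑ i, ∑ j, α i * a i j * (z i - z j) ^ 2 = 0 := by linarith
      have h2 := (Finset.sum_eq_zero_iff_of_nonneg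
        (fun i _ => Finset.sum_nonneg fun j _ => hnn1 i j)).mp h1 i (Finset.mem_univ i)
      have h3 := (Finset.sum_eq_zero_iff_of_nonneg (fun j _ => hnn1 i j)).mp h2 j
        (Finset.mem_univ j)
      have h4 := (mul_eq_zero.mp h3).resolve_left (mul_pos (hpos i) hij).ne'
      exact sub_eq_zero.mp (pow_eq_zero_iff two_ne_zero |>.mp h4)
    have hz4 : ∀ i, 0 < ε i → z i = 0 := by
      intro i hi
      have h1 : ∑ i, α i * ε i * z i ^ 2 = 0 := by linarith
      have h2 := (Finset.sum_eq_zero_iff_of_nonneg (fun i _ => hnn2 i)).mp h1 i (Finset.mem_univ i)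
      have h3 := (mul_eq_zero.mp h2).resolve_left (mul_pos (hpos i) hi).ne'
      exact pow_eq_zero_iff two_ne_zero |>.mp h3
    have hconst : ∀ i j, z i = z j := by
      intro i j
      have h1 := hconn {k | z i = z k} ⟨i, rfl⟩ (fun k hk l hkl => by
        have hk' : z i = z k := hk
        exact hk'.trans (hz3 k l hkl))
      have h2 : j ∈ {k | z i = z k} := by rw [h1]; trivial
      exact h2
    ext k
    rcases hz2 with ⟨i, hi⟩ | ⟨⟨i, hi⟩, ⟨j, hj⟩⟩
    · rw [hconst k i, hz4 i hi]; rfl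
    · have h1 := hconst k i
      have h2 := hconst k j
      simp only [Pi.zero_apply]
      linarith
  obtain ⟨c, hc, hcK⟩ := hKc.exists_forall_le' hQcont.continuousOn hKpos
  have hcard : (0 : ℝ) < Fintype.card ι := by exact_mod_cast Fintype.card_pos
  refine ⟨c / Fintype.card ι, div_pos hc hcard, fun z hz => ?_⟩
  change _ ≤ Q z
  rcases eq_or_ne z 0 with rfl | hz0
  · simp [hQ]
  have hn : 0 < ‖z‖ := norm_pos_iff.mpr hz0
  have hmem : ‖z‖⁻¹ • z ∈ K := by
    refine ⟨by simp [norm_smul, inv_mul_cancel₀ hn.ne'], ?_⟩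
    rcases hz with hz | ⟨μ, hμ, hμz⟩
    · exact Or.inl hz
    · right
      constructor
      · by_contra! h
        have : 0 < ∑ i, μ i * z i := Finset.sum_pos (fun i _ => mul_pos (hμ i) (by
          have := h i
          simp only [Pi.smul_apply, smul_eq_mul] at this
          exact (pos_iff_pos_of_mul_pos this).mp (inv_pos.mpr hn))) Finset.univ_nonempty
        linarith
      · by_contra! h
        have : 0 < ∑ i, μ i * -z i := Finset.sum_pos (fun i _ => mul_pos (hμ i) (by
          have := h i
          simp only [Pi.smul_apply, smul_eq_mul] at this
          have h2 : 0 < ‖z‖⁻¹ * -z i := by linarith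
          exact (pos_iff_pos_of_mul_pos h2).mp (inv_pos.mpr hn))) Finset.univ_nonempty
        simp only [mul_neg, Finset.sum_neg_distrib] at this
        linarith
  have h1 := hcK _ hmem
  have h2 : Q (‖z‖⁻¹ • z) = ‖z‖⁻¹ ^ 2 * Q z := by
    simp only [hQ, Finset.mul_sum, Pi.smul_apply, smul_eq_mul]
    refine Finset.sum_congr rfl fun i _ => ?_
    have : ∑ j, a i j * (‖z‖⁻¹ * z i - ‖z‖⁻¹ * z j) = ‖z‖⁻¹ * ∑ j, a i j * (z i - z j) := by
      rw [Finset.mul_sum]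
      exact Finset.sum_congr rfl fun j _ => by ring
    rw [this]
    ring
  have h3 : ∑ i, z i ^ 2 ≤ Fintype.card ι * ‖z‖ ^ 2 := by
    have := Finset.sum_le_card_nsmul Finset.univ (fun i => z i ^ 2) (‖z‖ ^ 2) (fun i _ => by
      have := norm_le_pi_norm z i
      rw [← sq_abs]
      exact pow_le_pow_left₀ (abs_nonneg _) this 2)
    simpa using this
  have h4 : c * ‖z‖ ^ 2 ≤ Q z := by
    rw [h2, inv_pow, inv_mul_eq_div, le_div_iff₀ (by positivity)] at h1
    exact h1
  calc c / Fintype.card ι * ∑ i, z i ^ 2 ≤ c / Fintype.card ι * (Fintype.card ι * ‖z‖ ^ 2) := by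
        gcongr
    _ = c * ‖z‖ ^ 2 := by field_simp
    _ ≤ Q z := h4

/-- The coercivity estimate for vector-valued functions on the nodes. -/
theorem StronglyConnectedWeights.exists_coercive_vec [Nonempty ι] {a : ι → ι → ℝ}
    (ha : ∀ i j, 0 ≤ a i j) (hconn : StronglyConnectedWeights a) {α : ι → ℝ} (hpos : ∀ i, 0 < α i)
    (hα : ∀ j, ∑ i, α i * a i j = α j * ∑ k, a j k) {ε : ι → ℝ} (hε : ∀ i, 0 ≤ ε i)
    (κ : Type*) [Fintype κ] :
    ∃ c > 0, ∀ z : ι → κ → ℝ,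
      ((∃ i, 0 < ε i) ∨ ∃ μ : ι → ℝ, (∀ i, 0 < μ i) ∧ ∑ i, μ i • z i = 0) →
      c * ∑ i, z i ⬝ᵥ z i ≤
        ∑ i, α i * (z i ⬝ᵥ (∑ j, a i j • (z i - z j) + ε i • z i)) := by
  obtain ⟨c, hc, h⟩ := hconn.exists_coercive ha hpos hα hε
  refine ⟨c, hc, fun z hz => ?_⟩
  have h1 : ∀ k, c * ∑ i, z i k ^ 2 ≤
      ∑ i, α i * z i k * (∑ j, a i j * (z i k - z j k) + ε i * z i k) := fun k =>
    h (fun i => z i k) (hz.imp id fun ⟨μ, hμ, hμz⟩ => ⟨μ, hμ, by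
      have := congrFun hμz k
      simpa [Finset.sum_apply] using this⟩)
  have h2 := Finset.sum_le_sum fun k (_ : k ∈ Finset.univ) => h1 k
  have h3 : ∑ k, c * ∑ i, z i k ^ 2 = c * ∑ i, z i ⬝ᵥ z i := by
    rw [← Finset.mul_sum, Finset.sum_comm]
    simp [dotProduct, sq]
  have h4 : ∑ k, ∑ i, α i * z i k * (∑ j, a i j * (z i k - z j k) + ε i * z i k) =
      ∑ i, α i * (z i ⬝ᵥ (∑ j, a i j • (z i - z j) + ε i • z i)) := by
    rw [Finset.sum_comm]
    refine Finset.sum_congr rfl fun i _ => ?_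
    simp [dotProduct, Finset.mul_sum, Finset.sum_apply, mul_assoc]
  rwa [h3, h4] at h2

end Graph

/-! ### Continuation of solutions of autonomous equations. -/

section GlobalExistence

variable {E : Type*} [NormedAddCommGroup E] [NormedSpace ℝ E]

/-- `y` solves `y' = v(y)`, `y(0) = x₀` at the times in `I`, a subset of `[0, ∞)`. -/
def IsForwardSolution (v : E → E) (x₀ : E) (I : Set ℝ) (y : ℝ → E) : Prop :=
  y 0 = x₀ ∧ ∀ t ∈ I, HasDerivWithinAt y (v (y t)) (Set.Ici 0) t

theorem IsForwardSolution.mono {v : E → E} {x₀ : E} {I J : Set ℝ} {y : ℝ → E}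
    (h : IsForwardSolution v x₀ I y) (hJ : J ⊆ I) : IsForwardSolution v x₀ J y :=
  ⟨h.1, fun t ht => h.2 t (hJ ht)⟩

variable [FiniteDimensional ℝ E]

theorem IsForwardSolution.eqOn {v : E → E} (hv : ContDiff ℝ 1 v) {x₀ : E} {s : ℝ} {y z : ℝ → E}
    (hy : IsForwardSolution v x₀ (Set.Ico 0 s) y) (hz : IsForwardSolution v x₀ (Set.Ico 0 s) z) :
    Set.EqOn y z (Set.Ico 0 s) := by
  intro t ht
  have hsub : Set.Icc 0 t ⊆ Set.Ico 0 s := fun u hu => ⟨hu.1, lt_of_le_of_lt hu.2 ht.2⟩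
  have hcont : ∀ {y : ℝ → E}, IsForwardSolution v x₀ (Set.Ico 0 s) y →
      ContinuousOn y (Set.Icc 0 t) := fun h u hu =>
    (h.2 u (hsub hu)).continuousWithinAt.mono fun w hw => hw.1
  have hcomp : IsCompact (y '' Set.Icc 0 t ∪ z '' Set.Icc 0 t) :=
    (isCompact_Icc.image_of_continuousOn (hcont hy)).union
      (isCompact_Icc.image_of_continuousOn (hcont hz))
  obtain ⟨R, hR⟩ := hcomp.isBounded.subset_closedBall 0
  have : ProperSpace E := FiniteDimensional.proper ℝ E
  obtain ⟨K, hK⟩ := hv.contDiffOn.exists_lipschitzOnWith one_ne_zero (convex_closedBall (0 : E) R)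
    (isCompact_closedBall (0 : E) R)
  have hder : ∀ {y : ℝ → E}, IsForwardSolution v x₀ (Set.Ico 0 s) y →
      ∀ u ∈ Set.Ico 0 t, HasDerivWithinAt y (v (y u)) (Set.Ici u) u := fun h u hu =>
    (h.2 u (hsub ⟨hu.1, hu.2.le⟩)).mono (Set.Ici_subset_Ici.mpr hu.1)
  exact ODE_solution_unique_of_mem_Icc_right (v := fun _ => v) (s := fun _ => Metric.closedBall 0 R)
    (fun _ _ => hK) (hcont hy) (hder hy)
    (fun u hu => hR (Or.inl ⟨u, ⟨hu.1, hu.2.le⟩, rfl⟩)) (hcont hz) (hder hz)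
    (fun u hu => hR (Or.inr ⟨u, ⟨hu.1, hu.2.le⟩, rfl⟩)) (by rw [hy.1, hz.1])
    ⟨ht.1, le_rfl⟩

/-- The maximal forward solution. -/
theorem exists_maximal_forwardSolution {v : E → E} (hv : ContDiff ℝ 1 v) (x₀ : E) :
    ∃ Y : ℝ → E, IsForwardSolution v x₀
      {t | 0 ≤ t ∧ ∃ s > t, ∃ y, IsForwardSolution v x₀ (Set.Ico 0 s) y} Y := by
  classical
  set J := {t : ℝ | 0 ≤ t ∧ ∃ s > t, ∃ y, IsForwardSolution v x₀ (Set.Ico 0 s) y} with hJ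
  have hJ' : ∀ t : J, ∃ s > (t : ℝ), ∃ y, IsForwardSolution v x₀ (Set.Ico 0 s) y :=
    fun t => t.2.2
  choose s hs y hy using hJ'
  set Y : ℝ → E := fun t => if h : t ∈ J then y ⟨t, h⟩ t else x₀ with hY
  -- By uniqueness the local choices agree wherever both are defined, so they glue.
  have hYeq : ∀ (t : J), Set.EqOn Y (y t) (Set.Ico 0 (s t)) := by
    intro t u hu
    have huJ : u ∈ J := ⟨hu.1, s t, hu.2, y t, hy t⟩
    have h1 : Y u = y ⟨u, huJ⟩ u := dif_pos huJ
    rw [h1]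
    rcases le_total (s t) (s ⟨u, huJ⟩) with h | h
    · exact ((hy ⟨u, huJ⟩).mono (Set.Ico_subset_Ico_right h)).eqOn hv (hy t) hu
    · exact (hy ⟨u, huJ⟩).eqOn hv ((hy t).mono (Set.Ico_subset_Ico_right h)) ⟨hu.1, hs ⟨u, huJ⟩⟩
  refine ⟨Y, ?_, fun t ht => ?_⟩
  · by_cases h : (0 : ℝ) ∈ J
    · rw [hY]
      simp only [h, dif_pos]
      exact (hy ⟨0, h⟩).1
    · simp [hY, h]
  · have hmem : t ∈ Set.Ico 0 (s ⟨t, ht⟩) := ⟨ht.1, hs ⟨t, ht⟩⟩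
    have h1 := (hy ⟨t, ht⟩).2 t hmem
    rw [← hYeq ⟨t, ht⟩ hmem] at h1
    refine h1.congr_of_eventuallyEq ?_ (hYeq ⟨t, ht⟩ hmem)
    filter_upwards [self_mem_nhdsWithin, nhdsWithin_le_nhds (Iio_mem_nhds hmem.2)] with u hu hu'
    exact hYeq ⟨t, ht⟩ ⟨hu, hu'⟩

theorem exists_forwardSolution_of_hasCompactSupport {w : E → E} (hw : ContDiff ℝ 1 w)
    (hc : HasCompactSupport w) (x₀ : E) {T : ℝ} (hT : 0 ≤ T) :
    ∃ y, IsForwardSolution w x₀ (Set.Ico 0 T) y := by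
  obtain ⟨K, hK⟩ := ContDiff.lipschitzWith_of_hasCompactSupport hc hw one_ne_zero
  obtain ⟨C, hC⟩ := hc.exists_bound_of_continuous hw.continuous
  have hC0 : 0 ≤ C := (norm_nonneg _).trans (hC x₀)
  have : CompleteSpace E := FiniteDimensional.complete ℝ E
  have hpl : IsPicardLindelof (fun _ => w) (tmin := 0) (tmax := T) ⟨0, le_rfl, hT⟩ x₀
      (⟨C, hC0⟩ * ⟨T, hT⟩) 0 ⟨C, hC0⟩ K := by
    refine IsPicardLindelof.of_time_independent (fun x _ => hC x) hK.lipschitzOnWith ?_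
    simp only [sub_zero, sub_self, NNReal.coe_zero]
    rw [max_eq_left hT]
    exact le_rfl
  obtain ⟨y, hy0, hy⟩ := hpl.exists_eq_forall_mem_Icc_hasDerivWithinAt₀
  refine ⟨y, hy0, fun t ht => (hy t ⟨ht.1, ht.2.le⟩).mono_of_mem_nhdsWithin ?_⟩
  filter_upwards [self_mem_nhdsWithin, nhdsWithin_le_nhds (Iio_mem_nhds ht.2)] with u hu hu'
  exact ⟨hu, le_of_lt hu'⟩

/-- If forward solutions on bounded intervals are bounded, then there is a solution on `[0, ∞)`. -/
theorem exists_global_forwardSolution {v : E → E} (hv : ContDiff ℝ 1 v) (x₀ : E)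
    (hbdd : ∀ τ y, IsForwardSolution v x₀ (Set.Ico 0 τ) y →
      ∃ R : ℝ, ∀ t ∈ Set.Ico 0 τ, ‖y t‖ ≤ R) :
    ∃ y, IsForwardSolution v x₀ (Set.Ici 0) y := by
  obtain ⟨Y, hY⟩ := exists_maximal_forwardSolution hv x₀
  set J := {t : ℝ | 0 ≤ t ∧ ∃ s > t, ∃ y, IsForwardSolution v x₀ (Set.Ico 0 s) y} with hJ
  suffices h : Set.Ici 0 ⊆ J from ⟨Y, hY.mono h⟩
  by_contra hne
  set N : Set ℝ := {t | 0 ≤ t ∧ t ∉ J} with hN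
  have hNne : N.Nonempty := by
    obtain ⟨t, ht0, ht⟩ := Set.not_subset.mp hne
    exact ⟨t, ht0, ht⟩
  have hNbdd : BddBelow N := ⟨0, fun t ht => ht.1⟩
  set τ := sInf N with hτ
  have hτ0 : 0 ≤ τ := le_csInf hNne fun t ht => ht.1
  have hsub : Set.Ico 0 τ ⊆ J := by
    intro t ht
    by_contra h
    exact absurd (csInf_le hNbdd ⟨ht.1, h⟩) (not_le.mpr ht.2)
  have hτJ : τ ∉ J := by
    rintro ⟨_, s, hs, y, hy⟩
    obtain ⟨t, ht, hts⟩ := exists_lt_of_csInf_lt hNne hs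
    exact ht.2 ⟨ht.1, s, hts, y, hy⟩
  apply hτJ
  obtain ⟨R₀, hR₀⟩ := hbdd τ Y (hY.mono hsub)
  set R := max R₀ ‖x₀‖ with hR
  have hR0 : 0 ≤ R := (norm_nonneg x₀).trans (le_max_right _ _)
  let f : ContDiffBump (0 : E) := ⟨R + 1, R + 2, by linarith, by linarith⟩
  -- The cut-off field has solutions on any bounded interval. Its solution agrees with the maximal
  -- one before τ, so it has norm at most R up to τ and below R + 1 a little beyond; there w = v,
  -- and the original solution extends past τ.
  set w : E → E := fun x => f x • v x with hw
  have hwv : ∀ x, ‖x‖ ≤ R + 1 → w x = v x := by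
    intro x hx
    have : f x = 1 := f.one_of_mem_closedBall (by simpa using hx)
    simp [hw, this]
  have hwc : ContDiff ℝ 1 w := f.contDiff.smul hv
  have : ProperSpace E := FiniteDimensional.proper ℝ E
  have hws : HasCompactSupport w := f.hasCompactSupport.smul_right
  obtain ⟨y, hy⟩ := exists_forwardSolution_of_hasCompactSupport hwc hws x₀
    (by linarith : (0 : ℝ) ≤ τ + 1)
  have hYw : IsForwardSolution w x₀ (Set.Ico 0 τ) Y := by
    refine ⟨hY.1, fun t ht => ?_⟩
    rw [hwv]
    · exact hY.2 t (hsub ht)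
    · have := hR₀ t ht
      have := le_max_left R₀ ‖x₀‖
      linarith
  have heq := (hy.mono (Set.Ico_subset_Ico_right (by linarith : τ ≤ τ + 1))).eqOn hwc hYw
  have hyR : ∀ t ∈ Set.Ico 0 τ, ‖y t‖ ≤ R := fun t ht => by
    rw [heq ht]
    exact (hR₀ t ht).trans (le_max_left _ _)
  have hcont : ContinuousWithinAt y (Set.Ici 0) τ :=
    (hy.2 τ ⟨hτ0, by linarith⟩).continuousWithinAt
  have hyτ : ‖y τ‖ ≤ R := by
    rcases hτ0.eq_or_lt with h | h
    · rw [← h, hy.1]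
      exact le_max_right _ _
    · have h1 : ContinuousWithinAt (fun t => ‖y t‖) (Set.Ico 0 τ) τ :=
        (hcont.mono fun t ht => ht.1).norm
      have h2 : τ ∈ closure (Set.Ico 0 τ) := by
        rw [closure_Ico h.ne]
        exact ⟨hτ0, le_rfl⟩
      have : (𝓝[Set.Ico 0 τ] τ).NeBot := mem_closure_iff_nhdsWithin_neBot.mp h2
      refine le_of_tendsto h1 ?_
      filter_upwards [self_mem_nhdsWithin] with t ht
      exact hyR t ht
  have hev : ∀ᶠ t in 𝓝[Set.Ici 0] τ, ‖y t‖ < R + 1 :=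
    hcont.norm.eventually_lt_const (by linarith)
  obtain ⟨δ, hδ, hball⟩ := Metric.mem_nhdsWithin_iff.mp hev
  refine ⟨hτ0, τ + min δ 1, by have := lt_min hδ one_pos; linarith, y, hy.1, fun t ht => ?_⟩
  have ht1 : t < τ + 1 := ht.2.trans_le (by have := min_le_right δ 1; linarith)
  have hty : ‖y t‖ ≤ R + 1 := by
    rcases lt_or_ge t τ with h | h
    · linarith [hyR t ⟨ht.1, h⟩]
    · refine le_of_lt (hball ⟨?_, ht.1⟩)
      rw [Metric.mem_ball, Real.dist_eq, abs_of_nonneg (by linarith)]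
      have := min_le_left δ 1
      linarith [ht.2]
  rw [← hwv _ hty]
  exact hy.2 t ⟨ht.1, ht1⟩

end GlobalExistence

/-! ### The weighted energy and the bound on large gains. -/

section Energy

variable {n m : ℕ} {ι : Type*} [Fintype ι]

theorem hasDerivWithinAt_quadratic {P : Matrix (Fin n) (Fin n) ℝ} (hP : Pᵀ = P)
    {u : ℝ → Fin n → ℝ} {u' : Fin n → ℝ} {s : Set ℝ} {t : ℝ} (hu : HasDerivWithinAt u u' s t) :
    HasDerivWithinAt (fun t => u t ⬝ᵥ (P *ᵥ u t)) (2 * (u t ⬝ᵥ (P *ᵥ u'))) s t := by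
  have hu' := hasDerivWithinAt_pi.mp hu
  have h1 : HasDerivWithinAt (fun t => ∑ i, u t i * ∑ j, P i j * u t j)
      (∑ i, (u' i * ∑ j, P i j * u t j + u t i * ∑ j, P i j * u' j)) s t :=
    HasDerivWithinAt.fun_sum fun i _ => (hu' i).mul
      (HasDerivWithinAt.fun_sum fun j _ => (hu' j).const_mul (P i j))
  refine h1.congr_deriv ?_
  rw [Finset.sum_add_distrib]
  change u' ⬝ᵥ (P *ᵥ u t) + u t ⬝ᵥ (P *ᵥ u') = _
  rw [dotProduct_mulVec_comm hP]
  ring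

theorem antitoneOn_of_hasDerivWithinAt {I : Set ℝ} (hI : I.OrdConnected) (hI0 : I ⊆ Set.Ici 0)
    {f f' : ℝ → ℝ} (hf : ∀ t ∈ I, HasDerivWithinAt f (f' t) (Set.Ici 0) t)
    (hf' : ∀ t ∈ I, f' t ≤ 0) : AntitoneOn f I := by
  have hder : ∀ t ∈ interior I, HasDerivAt f (f' t) t := fun t ht => by
    have h0 : Set.Ici (0 : ℝ) ∈ 𝓝 t := mem_of_superset (mem_interior_iff_mem_nhds.mp ht) hI0
    exact (hf t (interior_subset ht)).hasDerivAt h0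
  refine antitoneOn_of_deriv_nonpos hI.convex
    (fun t ht => (hf t ht).continuousWithinAt.mono hI0)
    (fun t ht => (hder t ht).differentiableAt.differentiableWithinAt) fun t ht => ?_
  rw [(hder t ht).deriv]
  exact hf' t (interior_subset ht)

theorem IsRiccatiSolution.transpose_eq {A : Matrix (Fin n) (Fin n) ℝ}
    {B : Matrix (Fin n) (Fin m) ℝ} {P : Matrix (Fin n) (Fin n) ℝ} (hP : IsRiccatiSolution A B P) :
    Pᵀ = P := by
  have := hP.1.isHermitian
  rwa [Matrix.IsHermitian, Matrix.conjTranspose_eq_transpose_of_trivial] at this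

theorem IsRiccatiSolution.pos {A : Matrix (Fin n) (Fin n) ℝ}
    {B : Matrix (Fin n) (Fin m) ℝ} {P : Matrix (Fin n) (Fin n) ℝ} (hP : IsRiccatiSolution A B P)
    {v : Fin n → ℝ} (hv : v ≠ 0) : 0 < v ⬝ᵥ (P *ᵥ v) := by
  simpa using hP.1.dotProduct_mulVec_pos hv

theorem IsRiccatiSolution.nonneg {A : Matrix (Fin n) (Fin n) ℝ}
    {B : Matrix (Fin n) (Fin m) ℝ} {P : Matrix (Fin n) (Fin n) ℝ} (hP : IsRiccatiSolution A B P)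
    (v : Fin n → ℝ) : 0 ≤ v ⬝ᵥ (P *ᵥ v) := by
  simpa using hP.1.posSemidef.dotProduct_mulVec_nonneg v

theorem dotProduct_mulVec_input {P : Matrix (Fin n) (Fin n) ℝ} (hP : Pᵀ = P)
    (B : Matrix (Fin n) (Fin m) ℝ) (v : Fin n → ℝ) (w : Fin m → ℝ) :
    v ⬝ᵥ (P *ᵥ (B *ᵥ w)) = ((Bᵀ * P) *ᵥ v) ⬝ᵥ w := by
  rw [dotProduct_mulVec_comm hP, ← dotProduct_transpose_mulVec, Matrix.mulVec_mulVec,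
    dotProduct_comm]

/-- The form in which the Riccati equation enters both energy estimates: the drift A contributes
decay except through the observed quantity BᵀPv. -/
theorem IsRiccatiSolution.two_mul_quadratic {A : Matrix (Fin n) (Fin n) ℝ}
    {B : Matrix (Fin n) (Fin m) ℝ} {P : Matrix (Fin n) (Fin n) ℝ} (hP : IsRiccatiSolution A B P)
    (v : Fin n → ℝ) :
    2 * (v ⬝ᵥ (P *ᵥ (A *ᵥ v))) = -(v ⬝ᵥ v) + ((Bᵀ * P) *ᵥ v) ⬝ᵥ ((Bᵀ * P) *ᵥ v) := by
  rw [← quadratic_lyapunov hP.transpose_eq]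
  have h : Aᵀ * P + P * A = (Bᵀ * P)ᵀ * (Bᵀ * P) - 1 := by
    rw [Matrix.transpose_mul, Matrix.transpose_transpose, hP.transpose_eq, ← sub_eq_zero]
    refine Eq.trans ?_ hP.2
    simp only [Matrix.mul_assoc]
    abel
  rw [h, Matrix.sub_mulVec, dotProduct_sub, ← Matrix.mulVec_mulVec, dotProduct_transpose_mulVec,
    Matrix.one_mulVec]
  ring

theorem two_mul_dotProduct_le {κ : Type*} [Fintype κ] (u v : κ → ℝ) :
    2 * (u ⬝ᵥ v) ≤ u ⬝ᵥ u + v ⬝ᵥ v := by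
  have := dotProduct_self_nonneg' (u - v)
  simp only [dotProduct_sub, sub_dotProduct] at this
  have h := dotProduct_comm u v
  linarith

/-- Cauchy–Schwarz for linear combinations of vectors. -/
theorem sum_smul_dotProduct_self_le {κ : Type*} [Fintype κ] (b : ι → ℝ) (u : ι → κ → ℝ) :
    (∑ j, b j • u j) ⬝ᵥ (∑ j, b j • u j) ≤ (∑ j, b j ^ 2) * ∑ j, u j ⬝ᵥ u j := by
  have h1 : ∀ k, (∑ j, b j • u j) k * (∑ j, b j • u j) k ≤ (∑ j, b j ^ 2) * ∑ j, u j k ^ 2 := by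
    intro k
    have := Finset.sum_mul_sq_le_sq_mul_sq Finset.univ b (fun j => u j k)
    simpa [Finset.sum_apply, sq] using this
  refine (Finset.sum_le_sum fun k _ => h1 k).trans (le_of_eq ?_)
  rw [← Finset.mul_sum, Finset.sum_comm]
  simp [dotProduct, sq]

/-- The Laplacian of the weights `a`, grounded with the weights `ε`. -/
noncomputable def groundedLaplacian [DecidableEq ι] (a : ι → ι → ℝ) (ε : ι → ℝ) : Matrix ι ι ℝ :=
  Matrix.diagonal (fun i => ∑ j, a i j + ε i) - Matrix.of a

theorem groundedLaplacian_sum_smul [DecidableEq ι] (a : ι → ι → ℝ) (ε : ι → ℝ) {V : Type*}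
    [AddCommGroup V] [Module ℝ V] (z : ι → V) (i : ι) :
    ∑ k, groundedLaplacian a ε i k • z k = ∑ j, a i j • (z i - z j) + ε i • z i := by
  have h : ∑ k, Matrix.diagonal (fun i => ∑ j, a i j + ε i) i k • z k =
      (∑ j, a i j + ε i) • z i := by
    rw [Finset.sum_eq_single i]
    · simp
    · intro k _ hk
      simp [Matrix.diagonal_apply_ne' _ hk]
    · simp
  simp only [groundedLaplacian, Matrix.sub_apply, sub_smul, Finset.sum_sub_distrib, h,
    Matrix.of_apply, smul_sub, add_smul, Finset.sum_smul]
  abel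

/-- Decay of the weighted energy `∑ i, (α i / ρ i) e iᵀ P e i`, as an algebraic inequality. -/
theorem IsRiccatiSolution.energy_decay {A : Matrix (Fin n) (Fin n) ℝ}
    {B : Matrix (Fin n) (Fin m) ℝ} {P : Matrix (Fin n) (Fin n) ℝ} (hP : IsRiccatiSolution A B P)
    {α ρ ρ' : ι → ℝ} (hα : ∀ i, 0 < α i) (hρ : ∀ i, 0 < ρ i) (hρ' : ∀ i, 0 ≤ ρ' i) {c : ℝ}
    (hc : ∀ i, 2 * α i ≤ c * ρ i) {e : ι → Fin n → ℝ} {y ω : ι → Fin m → ℝ} {r : Fin n → ℝ}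
    (hr : r = 0 ∨ ∑ i, (α i / ρ i) • e i = 0)
    (hcoer : c * ∑ i, ((Bᵀ * P) *ᵥ e i) ⬝ᵥ ((Bᵀ * P) *ᵥ e i) ≤
      ∑ i, α i * (((Bᵀ * P) *ᵥ e i) ⬝ᵥ y i)) :
    ∑ i, (-(α i * ρ' i) / ρ i ^ 2 * (e i ⬝ᵥ (P *ᵥ e i)) + α i / ρ i * (2 * (e i ⬝ᵥ (P *ᵥ
      (A *ᵥ e i - ρ i • (B *ᵥ y i) + B *ᵥ ω i + r))))) ≤
      -(c * ∑ i, ((Bᵀ * P) *ᵥ e i) ⬝ᵥ ((Bᵀ * P) *ᵥ e i)) + c / 2 * ∑ i, ω i ⬝ᵥ ω i := by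
  have hr' : ∑ i, α i / ρ i * (e i ⬝ᵥ (P *ᵥ r)) = 0 := by
    rcases hr with rfl | h
    · simp
    · have : ∑ i, α i / ρ i * (e i ⬝ᵥ (P *ᵥ r)) = (∑ i, (α i / ρ i) • e i) ⬝ᵥ (P *ᵥ r) := by
        simp [sum_dotProduct]
      rw [this, h, zero_dotProduct]
  have hi : ∀ i, -(α i * ρ' i) / ρ i ^ 2 * (e i ⬝ᵥ (P *ᵥ e i)) + α i / ρ i * (2 * (e i ⬝ᵥ (P *ᵥ
      (A *ᵥ e i - ρ i • (B *ᵥ y i) + B *ᵥ ω i + r)))) ≤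
      c * (((Bᵀ * P) *ᵥ e i) ⬝ᵥ ((Bᵀ * P) *ᵥ e i)) - 2 * (α i * (((Bᵀ * P) *ᵥ e i) ⬝ᵥ y i)) +
        c / 2 * (ω i ⬝ᵥ ω i) + 2 * (α i / ρ i * (e i ⬝ᵥ (P *ᵥ r))) := by
    intro i
    -- Growing gains only shrink the weights α_i/ρ_i, so this term can be dropped.
    have h1 : -(α i * ρ' i) / ρ i ^ 2 * (e i ⬝ᵥ (P *ᵥ e i)) ≤ 0 := by
      refine mul_nonpos_of_nonpos_of_nonneg ?_ (hP.nonneg _)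
      exact div_nonpos_of_nonpos_of_nonneg (by nlinarith [mul_nonneg (hα i).le (hρ' i)])
        (sq_nonneg _)
    have h2 := hP.two_mul_quadratic (e i)
    have h3 : α i / ρ i ≤ c / 2 := by
      rw [div_le_iff₀ (hρ i)]
      linarith [hc i]
    have h4 : 0 < α i / ρ i := div_pos (hα i) (hρ i)
    -- The reason for the weight 1/ρ_i: the gain disappears from the feedback term, leaving constant
    -- weights α_i.
    have h5 : α i / ρ i * ρ i = α i := div_mul_cancel₀ _ (hρ i).ne'
    rw [Matrix.mulVec_add, Matrix.mulVec_add, Matrix.mulVec_sub, Matrix.mulVec_smul,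
      dotProduct_add, dotProduct_add, dotProduct_sub, dotProduct_smul, smul_eq_mul,
      dotProduct_mulVec_input hP.transpose_eq B (e i) (y i),
      dotProduct_mulVec_input hP.transpose_eq B (e i) (ω i)]
    set η := (Bᵀ * P) *ᵥ e i
    have h6 := two_mul_dotProduct_le η (ω i)
    have h7 := dotProduct_self_nonneg' η
    have h8 := dotProduct_self_nonneg' (ω i)
    have h9 := dotProduct_self_nonneg' (e i)
    have h10 : α i / ρ i * (2 * (e i ⬝ᵥ P *ᵥ A *ᵥ e i - ρ i * (η ⬝ᵥ y i) + η ⬝ᵥ ω i +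
        e i ⬝ᵥ P *ᵥ r)) = α i / ρ i * (2 * (e i ⬝ᵥ P *ᵥ A *ᵥ e i)) -
        2 * ((α i / ρ i * ρ i) * (η ⬝ᵥ y i)) + α i / ρ i * (2 * (η ⬝ᵥ ω i)) +
        2 * (α i / ρ i * (e i ⬝ᵥ P *ᵥ r)) := by ring
    rw [h10, h5, h2]
    have h11 : α i / ρ i * (-(e i ⬝ᵥ e i) + η ⬝ᵥ η) ≤ c / 2 * (η ⬝ᵥ η) := by
      have : α i / ρ i * (η ⬝ᵥ η) ≤ c / 2 * (η ⬝ᵥ η) := by gcongr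
      have : 0 ≤ α i / ρ i * (e i ⬝ᵥ e i) := by positivity
      linarith
    have h12 : α i / ρ i * (2 * (η ⬝ᵥ ω i)) ≤ c / 2 * (η ⬝ᵥ η + ω i ⬝ᵥ ω i) :=
      (mul_le_mul_of_nonneg_left h6 h4.le).trans (by gcongr)
    linarith
  refine (Finset.sum_le_sum fun i _ => hi i).trans ?_
  simp only [Finset.sum_add_distrib, Finset.sum_sub_distrib, ← Finset.mul_sum]
  rw [hr']
  linarith

/-- Large adaptive gains on a strongly connected part of the network, driven by
square-integrable inputs, remain bounded. -/
theorem IsRiccatiSolution.exists_gain_bound [Nonempty ι] [DecidableEq ι]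
    {A : Matrix (Fin n) (Fin n) ℝ}
    {B : Matrix (Fin n) (Fin m) ℝ} {P : Matrix (Fin n) (Fin n) ℝ} (hP : IsRiccatiSolution A B P)
    {a : ι → ι → ℝ} (ha : ∀ i j, 0 ≤ a i j) (hconn : StronglyConnectedWeights a) {α : ι → ℝ}
    (hpos : ∀ i, 0 < α i) (hα : ∀ j, ∑ i, α i * a i j = α j * ∑ k, a j k) {ε : ι → ℝ}
    (hε : ∀ i, 0 ≤ ε i) :
    ∃ R₀ > 0, ∀ (I : Set ℝ) (t₀ : ℝ) (e : ι → ℝ → Fin n → ℝ) (ρ : ι → ℝ → ℝ)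
      (y ω : ι → ℝ → Fin m → ℝ) (r : ℝ → Fin n → ℝ) (g g' : ℝ → ℝ) (Γ : ℝ),
      I.OrdConnected → I ⊆ Set.Ici 0 → t₀ ∈ I → (∀ t ∈ I, t₀ ≤ t) →
      (∀ i, ∀ t ∈ I, HasDerivWithinAt (e i)
        (A *ᵥ e i t - ρ i t • (B *ᵥ y i t) + B *ᵥ ω i t + r t) (Set.Ici 0) t) →
      (∀ i, ∀ t ∈ I, HasDerivWithinAt (ρ i) (y i t ⬝ᵥ y i t) (Set.Ici 0) t) →
      (∀ t ∈ I, HasDerivWithinAt g (g' t) (Set.Ici 0) t) →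
      (∀ t ∈ I, ∑ i, ω i t ⬝ᵥ ω i t ≤ g' t) → (∀ t ∈ I, g t ≤ Γ) →
      (∀ i, ∀ t ∈ I, y i t = (Bᵀ * P) *ᵥ ∑ k, groundedLaplacian a ε i k • e k t) →
      (∀ t ∈ I, (r t = 0 ∧ ∃ i, 0 < ε i) ∨ ∑ i, (α i / ρ i t) • e i t = 0) →
      (∀ i, ∀ t ∈ I, R₀ ≤ ρ i t) →
      ∃ R, ∀ i, ∀ t ∈ I, ρ i t ≤ R := by
  obtain ⟨c, hc, hcoer⟩ := hconn.exists_coercive_vec ha hpos hα hε (Fin m)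
  -- Bounds ∑ |y_i|² by C ∑ |BᵀPe_i|²; the summand 1 only makes C positive.
  set C : ℝ := ∑ i, ∑ k, groundedLaplacian a ε i k ^ 2 + 1 with hC
  have hC0 : 0 < C := by positivity
  -- Large enough that ρ_i ≥ R₀ implies 2α_i ≤ cρ_i for every i, as the energy decay requires.
  set R₀ : ℝ := ∑ i, 2 * α i / c with hR₀
  have hR₀pos : 0 < R₀ := Finset.sum_pos
    (fun i _ => div_pos (mul_pos two_pos (hpos i)) hc) Finset.univ_nonempty
  refine ⟨R₀, hR₀pos, fun I t₀ e ρ y ω r g g' Γ hI hI0 ht₀ hmin he hρ hg hωg hΓ hy hr hlarge => ?_⟩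
  have hρpos : ∀ i, ∀ t ∈ I, 0 < ρ i t := fun i t ht => hR₀pos.trans_le (hlarge i t ht)
  set V : ℝ → ℝ := fun t => ∑ i, α i / ρ i t * (e i t ⬝ᵥ (P *ᵥ e i t)) with hV
  have hVnn : ∀ t ∈ I, 0 ≤ V t := fun t ht => Finset.sum_nonneg fun i _ =>
    mul_nonneg (div_pos (hpos i) (hρpos i t ht)).le (hP.nonneg _)
  have hVder : ∀ t ∈ I, HasDerivWithinAt V
      (∑ i, (-(α i * (y i t ⬝ᵥ y i t)) / ρ i t ^ 2 * (e i t ⬝ᵥ (P *ᵥ e i t)) +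
        α i / ρ i t * (2 * (e i t ⬝ᵥ (P *ᵥ
          (A *ᵥ e i t - ρ i t • (B *ᵥ y i t) + B *ᵥ ω i t + r t)))))) (Set.Ici 0) t := by
    intro t ht
    refine HasDerivWithinAt.fun_sum fun i _ => ?_
    refine HasDerivWithinAt.mul ?_ (hasDerivWithinAt_quadratic hP.transpose_eq (he i t ht))
    refine ((hasDerivWithinAt_const t _ (α i)).div (hρ i t ht) (hρpos i t ht).ne').congr_deriv ?_
    rw [zero_mul, zero_sub]
  have hmain : ∀ t ∈ I, ∑ i, (-(α i * (y i t ⬝ᵥ y i t)) / ρ i t ^ 2 * (e i t ⬝ᵥ (P *ᵥ e i t)) +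
        α i / ρ i t * (2 * (e i t ⬝ᵥ (P *ᵥ
          (A *ᵥ e i t - ρ i t • (B *ᵥ y i t) + B *ᵥ ω i t + r t))))) +
        c / C * ∑ i, y i t ⬝ᵥ y i t - c / 2 * g' t ≤ 0 := by
    intro t ht
    have hyη : ∀ i, y i t = ∑ k, groundedLaplacian a ε i k • ((Bᵀ * P) *ᵥ e k t) := by
      intro i
      rw [hy i t ht, Matrix.mulVec_sum]
      simp only [Matrix.mulVec_smul]
    have h1 := hP.energy_decay (ρ := fun i => ρ i t) (ρ' := fun i => y i t ⬝ᵥ y i t) (c := c)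
      (e := fun i => e i t) (y := fun i => y i t) (ω := fun i => ω i t) (r := r t) hpos
      (fun i => hρpos i t ht) (fun i => dotProduct_self_nonneg' _) (fun i => ?_)
      ((hr t ht).imp And.left id) ?_
    · have h2 : ∑ i, y i t ⬝ᵥ y i t ≤
          C * ∑ i, ((Bᵀ * P) *ᵥ e i t) ⬝ᵥ ((Bᵀ * P) *ᵥ e i t) := by
        have h3 : ∀ i, y i t ⬝ᵥ y i t ≤ (∑ k, groundedLaplacian a ε i k ^ 2) *
            ∑ i, ((Bᵀ * P) *ᵥ e i t) ⬝ᵥ ((Bᵀ * P) *ᵥ e i t) := fun i => by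
          rw [hyη i]
          exact sum_smul_dotProduct_self_le _ _
        refine (Finset.sum_le_sum fun i _ => h3 i).trans ?_
        rw [← Finset.sum_mul]
        refine mul_le_mul_of_nonneg_right (by rw [hC]; linarith) ?_
        exact Finset.sum_nonneg fun i _ => dotProduct_self_nonneg' _
      have h4 : c / C * ∑ i, y i t ⬝ᵥ y i t ≤
          c * ∑ i, ((Bᵀ * P) *ᵥ e i t) ⬝ᵥ ((Bᵀ * P) *ᵥ e i t) := by
        rw [div_mul_eq_mul_div, div_le_iff₀ hC0, mul_assoc]
        refine mul_le_mul_of_nonneg_left (h2.trans (le_of_eq (mul_comm _ _))) hc.le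
      have h5 := mul_le_mul_of_nonneg_left (hωg t ht) (by positivity : 0 ≤ c / 2)
      linarith
    · have h2 := hlarge i t ht
      have h3 : 2 * α i / c ≤ R₀ := Finset.single_le_sum (f := fun i => 2 * α i / c)
        (fun i _ => (div_pos (mul_pos two_pos (hpos i)) hc).le) (Finset.mem_univ i)
      have h4 := h3.trans h2
      rwa [div_le_iff₀' hc] at h4
    · have h2 := hcoer (fun i => (Bᵀ * P) *ᵥ e i t) ((hr t ht).imp And.right fun h =>
        ⟨fun i => α i / ρ i t, fun i => div_pos (hpos i) (hρpos i t ht), by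
          simp only [← Matrix.mulVec_smul]
          rw [← Matrix.mulVec_sum, h, Matrix.mulVec_zero]⟩)
      refine h2.trans (le_of_eq (Finset.sum_congr rfl fun i _ => ?_))
      rw [hyη i, groundedLaplacian_sum_smul]
  -- The dissipation dominates ∑ |y_i|² = ∑ ρ_i', so it integrates to the gains themselves.
  have hanti : AntitoneOn (fun t => V t + c / C * ∑ i, ρ i t - c / 2 * g t) I :=
    antitoneOn_of_hasDerivWithinAt hI hI0 (fun t ht => ((hVder t ht).add
      ((HasDerivWithinAt.fun_sum fun i _ => hρ i t ht).const_mul (c / C))).sub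
      ((hg t ht).const_mul (c / 2))) hmain
  refine ⟨C / c * (V t₀ + c / C * ∑ i, ρ i t₀ - c / 2 * g t₀ + c / 2 * Γ), fun i t ht => ?_⟩
  have h1 := hanti ht₀ ht (hmin t ht)
  simp only at h1
  have h2 := hVnn t ht
  have h3 := mul_le_mul_of_nonneg_left (hΓ t ht) (by positivity : 0 ≤ c / 2)
  have h4 : ρ i t ≤ ∑ i, ρ i t := Finset.single_le_sum (f := fun i => ρ i t)
    (fun i _ => (hρpos i t ht).le) (Finset.mem_univ i)
  have h5 : c / C * ρ i t ≤ c / C * ∑ i, ρ i t := by gcongr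
  have h6 : c / C * ρ i t ≤ V t₀ + c / C * ∑ i, ρ i t₀ - c / 2 * g t₀ + c / 2 * Γ := by linarith
  calc ρ i t = C / c * (c / C * ρ i t) := by field_simp
    _ ≤ _ := by gcongr

end Energy

/-! ### Boundedness of the adaptive gains. -/

section Network

variable {n m N : ℕ}

/-- `(x, ρ)` solves the network under the adaptive protocol at the times in `I ⊆ [0, ∞)`. -/
structure IsAdaptiveSolution (A : Matrix (Fin n) (Fin n) ℝ) (B : Matrix (Fin n) (Fin m) ℝ)
    (P : Matrix (Fin n) (Fin n) ℝ) (G : WeightedGraph N) (I : Set ℝ)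
    (x : Fin N → ℝ → Fin n → ℝ) (ρ : Fin N → ℝ → ℝ) : Prop where
  hasDeriv_state : ∀ i, ∀ t ∈ I, HasDerivWithinAt (x i)
    (A *ᵥ x i t - ρ i t • (B *ᵥ ((Bᵀ * P) *ᵥ G.zeta (fun j => x j t) i))) (Set.Ici 0) t
  hasDeriv_gain : ∀ i, ∀ t ∈ I, HasDerivWithinAt (ρ i)
    (((Bᵀ * P) *ᵥ G.zeta (fun j => x j t) i) ⬝ᵥ ((Bᵀ * P) *ᵥ G.zeta (fun j => x j t) i))
    (Set.Ici 0) t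

variable {A : Matrix (Fin n) (Fin n) ℝ} {B : Matrix (Fin n) (Fin m) ℝ}
  {P : Matrix (Fin n) (Fin n) ℝ} {G : WeightedGraph N} {I : Set ℝ}
  {x : Fin N → ℝ → Fin n → ℝ} {ρ : Fin N → ℝ → ℝ}

theorem IsAdaptiveSolution.monotoneOn (h : IsAdaptiveSolution A B P G I x ρ)
    (hI : I.OrdConnected) (hI0 : I ⊆ Set.Ici 0) (i : Fin N) : MonotoneOn (ρ i) I := by
  have := antitoneOn_of_hasDerivWithinAt hI hI0 (f := fun t => -ρ i t)
    (fun t ht => (h.hasDeriv_gain i t ht).neg)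
    (fun t _ => neg_nonpos.mpr (dotProduct_self_nonneg' _))
  intro s hs t ht hst
  exact neg_le_neg_iff.mp (this hs ht hst)

theorem sum_eq_sum_subtype_add {ι V : Type*} [Fintype ι] [AddCommMonoid V] {p q : ι → Prop}
    [Fintype {i // p i}] [Fintype {i // q i}] (hpq : ∀ i, p i → ¬ q i) {f : ι → V}
    (hf : ∀ i, ¬ p i → ¬ q i → f i = 0) :
    ∑ i, f i = ∑ i : {i // p i}, f i + ∑ i : {i // q i}, f i := by
  classical
  rw [← Finset.sum_subtype (Finset.univ.filter p) (by simp) f,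
    ← Finset.sum_subtype (Finset.univ.filter q) (by simp) f, ← Finset.sum_union]
  · refine (Finset.sum_subset (Finset.subset_univ _) fun i _ hi => ?_).symm
    simp only [Finset.mem_union, Finset.mem_filter, Finset.mem_univ, true_and, not_or] at hi
    exact hf i hi.1 hi.2
  · rw [Finset.disjoint_filter]
    exact fun i _ => hpq i

/-- In-neighbour-closed parts of a finite set of nodes contain strongly connected ones. -/
theorem exists_stronglyConnected_source {ι : Type*} [Finite ι] (a : ι → ι → ℝ) {S : Set ι}
    (hS : S.Nonempty) :
    ∃ T ⊆ S, T.Nonempty ∧ (∀ i ∈ T, ∀ j ∈ S, 0 < a i j → j ∈ T) ∧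
      StronglyConnectedWeights (fun i j : T => a i j) := by
  -- Take T minimal: a nonempty subset of T closed under in-neighbours in T is a competitor, hence
  -- all of T.
  obtain ⟨T, hT⟩ := (Set.toFinite
    {T : Set ι | T ⊆ S ∧ T.Nonempty ∧ ∀ i ∈ T, ∀ j ∈ S, 0 < a i j → j ∈ T}).exists_minimal
    ⟨S, subset_rfl, hS, fun _ _ j hj _ => hj⟩
  obtain ⟨hTS, hTne, hTcl⟩ := hT.prop
  refine ⟨T, hTS, hTne, hTcl, fun U hU hUcl => ?_⟩
  have h1 : T ⊆ Subtype.val '' U := by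
    refine hT.le_of_le ⟨?_, hU.image _, ?_⟩ ?_
    · rintro _ ⟨i, _, rfl⟩
      exact hTS i.2
    · rintro _ ⟨i, hi, rfl⟩ j hj hij
      exact ⟨⟨j, hTcl i i.2 j hj hij⟩, hUcl i hi ⟨j, _⟩ hij, rfl⟩
    · rintro _ ⟨i, _, rfl⟩
      exact i.2
  ext i
  simp only [Set.mem_univ, iff_true]
  obtain ⟨j, hj, hji⟩ := h1 i.2
  rwa [Subtype.ext hji] at hj

theorem groundedLaplacian_isUnit_det {ι : Type*} [Fintype ι] [DecidableEq ι] [Nonempty ι]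
    {a : ι → ι → ℝ} (ha : ∀ i j, 0 ≤ a i j) (hconn : StronglyConnectedWeights a) {α : ι → ℝ}
    (hpos : ∀ i, 0 < α i) (hα : ∀ j, ∑ i, α i * a i j = α j * ∑ k, a j k) {ε : ι → ℝ}
    (hε : ∀ i, 0 ≤ ε i) (hε' : ∃ i, 0 < ε i) : IsUnit (groundedLaplacian a ε).det := by
  obtain ⟨c, hc, hcoer⟩ := hconn.exists_coercive ha hpos hα hε
  rw [isUnit_iff_ne_zero]
  intro h0
  obtain ⟨z, hz, hMz⟩ := Matrix.exists_mulVec_eq_zero_iff.mpr h0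
  apply hz
  have h1 := hcoer z (Or.inl hε')
  have h2 : ∀ i, ∑ j, a i j * (z i - z j) + ε i * z i = 0 := by
    intro i
    have h3 := groundedLaplacian_sum_smul a ε z i
    simp only [smul_eq_mul] at h3
    rw [← h3]
    exact congrFun hMz i
  simp only [h2, mul_zero, Finset.sum_const_zero] at h1
  have h4 : ∑ i, z i ^ 2 = 0 :=
    le_antisymm (by by_contra! h; nlinarith [mul_pos hc h])
      (Finset.sum_nonneg fun i _ => sq_nonneg _)
  ext i
  exact pow_eq_zero_iff two_ne_zero |>.mp
    ((Finset.sum_eq_zero_iff_of_nonneg fun i _ => sq_nonneg (z i)).mp h4 i (Finset.mem_univ i))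

/-- The adaptive gains are bounded along every solution, on bounded and unbounded intervals. -/
theorem IsAdaptiveSolution.bddAbove (hP : IsRiccatiSolution A B P)
    (h : IsAdaptiveSolution A B P G I x ρ) (hI : I.OrdConnected) (hI0 : I ⊆ Set.Ici 0)
    (i : Fin N) : BddAbove (ρ i '' I) := by
  classical
  by_contra hi
  set S : Set (Fin N) := {i | ¬ BddAbove (ρ i '' I)} with hS
  obtain ⟨T, hTS, hTne, hTcl, hconn⟩ := exists_stronglyConnected_source G.adj (S := S) ⟨i, hi⟩
  have : Nonempty T := hTne.to_subtype
  set a : T → T → ℝ := fun i j => G.adj i j with ha_def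
  have ha : ∀ i j, 0 ≤ a i j := fun i j => G.adj_nonneg i j
  obtain ⟨α, hpos, hα⟩ := hconn.exists_pos_left_null ha
  set W : Matrix T {o // o ∉ S} ℝ := Matrix.of fun i o => G.adj i o with hW
  have hWnn : ∀ i o, 0 ≤ W i o := fun i o => G.adj_nonneg i o
  set ε : T → ℝ := fun i => ∑ o, W i o with hε_def
  have hε : ∀ i, 0 ≤ ε i := fun i => Finset.sum_nonneg fun o _ => hWnn i o
  set M := groundedLaplacian a ε with hM
  obtain ⟨R₀, hR₀, hgain⟩ := hP.exists_gain_bound ha hconn hpos hα hε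
  have hmono := h.monotoneOn hI hI0
  -- from some time on, all gains in `T` exceed the threshold
  have hbig : ∀ i : T, ∃ t ∈ I, R₀ ≤ ρ i t := by
    intro i
    by_contra! hlt
    exact hTS i.2 ⟨R₀, by rintro _ ⟨t, ht, rfl⟩; exact (hlt t ht).le⟩
  choose s hsI hs using hbig
  set t₀ := Finset.univ.sup' Finset.univ_nonempty s with ht₀
  have ht₀I : t₀ ∈ I := by
    obtain ⟨j, _, hj⟩ := Finset.exists_mem_eq_sup' Finset.univ_nonempty s
    rw [ht₀, hj]
    exact hsI j
  set J := I ∩ Set.Ici t₀ with hJ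
  have hJI : J ⊆ I := Set.inter_subset_left
  have hJ0 : J ⊆ Set.Ici 0 := hJI.trans hI0
  have hJc : J.OrdConnected := hI.inter Set.ordConnected_Ici
  have ht₀J : t₀ ∈ J := ⟨ht₀I, Set.self_mem_Ici⟩
  have hlarge : ∀ i : T, ∀ t ∈ J, R₀ ≤ ρ i t := fun i t ht =>
    (hs i).trans (hmono i (hsI i) ht.1 ((Finset.le_sup' s (Finset.mem_univ i)).trans ht.2))
  set y : Fin N → ℝ → Fin m → ℝ := fun i t => (Bᵀ * P) *ᵥ G.zeta (fun j => x j t) i with hy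
  have hzeta : ∀ (i : T) (t : ℝ), G.zeta (fun j => x j t) i =
      ∑ k, M i k • x k t - ∑ o, W i o • x o t := by
    intro i t
    rw [hM, groundedLaplacian_sum_smul a ε (fun k : T => x k t) i, WeightedGraph.zeta,
      sum_eq_sum_subtype_add (p := (· ∈ T)) (q := (· ∉ S)) (fun i hi hiS => hiS (hTS hi))]
    · simp only [hε_def, smul_sub, Finset.sum_sub_distrib, Finset.sum_smul]
      simp only [ha_def, hW, Matrix.of_apply]
      abel
    · intro j hjT hjS
      have : G.adj i j = 0 := le_antisymm (not_lt.mp fun hlt =>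
        hjT (hTcl i i.2 j (not_not.mp hjS) hlt)) (G.adj_nonneg _ _)
      rw [this, zero_smul]
  -- bounded gains in `T` contradict the choice of `T`
  suffices hfin : ∃ R, ∀ i : T, ∀ t ∈ J, ρ i t ≤ R by
    obtain ⟨R, hR⟩ := hfin
    obtain ⟨i, hiT⟩ := hTne
    refine hTS hiT ⟨R, ?_⟩
    rintro _ ⟨t, ht, rfl⟩
    rcases le_total t₀ t with htt | htt
    · exact hR ⟨i, hiT⟩ t ⟨ht, htt⟩
    · exact (hmono i ht ht₀I htt).trans (hR ⟨i, hiT⟩ t₀ ht₀J)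
  have hρJ : ∀ i, ∀ t ∈ J, HasDerivWithinAt (ρ i) (y i t ⬝ᵥ y i t) (Set.Ici 0) t :=
    fun i t ht => h.hasDeriv_gain i t (hJI ht)
  have hxJ : ∀ i, ∀ t ∈ J, HasDerivWithinAt (x i)
      (A *ᵥ x i t - ρ i t • (B *ᵥ y i t)) (Set.Ici 0) t :=
    fun i t ht => h.hasDeriv_state i t (hJI ht)
  by_cases hgr : ∃ i, 0 < ε i
  · -- grounded case
    have hdet := groundedLaplacian_isUnit_det ha hconn hpos hα hε hgr
    -- With MK = W the signals in T become M(x_T - Kx_o), so e = x_T - Kx_o obeys the agent dynamics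
    -- with the extra input ω = Kρ_o y_o. This is square integrable since the gains outside S are
    -- bounded.
    set K : Matrix T {o // o ∉ S} ℝ := M⁻¹ * W with hK
    have hMK : M * K = W := Matrix.mul_nonsing_inv_cancel_left _ _ hdet
    have hbd : ∀ o : {o // o ∉ S}, BddAbove (ρ o '' I) := fun o => not_not.mp o.2
    choose Ro hRo using hbd
    -- Gains may be negative, so the lower bound at t₀ is needed besides the upper one.
    have hρabs : ∀ (o : {o // o ∉ S}), ∀ t ∈ J, ρ o t ^ 2 ≤ ρ o t₀ ^ 2 + Ro o ^ 2 := by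
      intro o t ht
      have h1 := hRo o ⟨t, ht.1, rfl⟩
      have h2 := hmono o ht₀I ht.1 ht.2
      rcases le_total 0 (ρ o t) with h3 | h3
      · nlinarith [sq_nonneg (ρ o t₀)]
      · nlinarith [sq_nonneg (Ro o)]
    set Cω : ℝ := ∑ i, ∑ o, K i o ^ 2 * (ρ o t₀ ^ 2 + Ro o ^ 2) with hCω
    have hCω0 : 0 ≤ Cω := by positivity
    refine hgain J t₀ (fun i t => x i t - ∑ o, K i o • x o t) (fun i => ρ i) (fun i => y i)
      (fun i t => ∑ o, (K i o * ρ o t) • y o t) 0 (fun t => Cω * ∑ o : {o // o ∉ S}, ρ o t)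
      (fun t => Cω * ∑ o : {o // o ∉ S}, y o t ⬝ᵥ y o t) (Cω * ∑ o, Ro o) hJc hJ0 ht₀J
      (fun t ht => ht.2) ?_ (fun i => hρJ i) ?_ ?_ ?_ ?_ (fun t _ => Or.inl ⟨rfl, hgr⟩) hlarge
    · intro i t ht
      refine ((hxJ i t ht).sub (HasDerivWithinAt.fun_sum
        fun (o : {o // o ∉ S}) _ => (hxJ o t ht).const_smul (K i o))).congr_deriv ?_
      simp only [Matrix.mulVec_sub, Matrix.mulVec_sum, Matrix.mulVec_smul, smul_sub,
        Finset.sum_sub_distrib, smul_smul, Pi.zero_apply, add_zero]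
      abel
    · intro t ht
      exact (HasDerivWithinAt.fun_sum fun (o : {o // o ∉ S}) _ => hρJ o t ht).const_mul Cω
    · intro t ht
      rw [hCω, Finset.sum_mul]
      refine Finset.sum_le_sum fun i _ => (sum_smul_dotProduct_self_le _ _).trans ?_
      refine mul_le_mul_of_nonneg_right (Finset.sum_le_sum fun o _ => ?_)
        (Finset.sum_nonneg fun o _ => dotProduct_self_nonneg' _)
      rw [mul_pow]
      exact mul_le_mul_of_nonneg_left (hρabs o t ht) (sq_nonneg _)
    · intro t ht
      exact mul_le_mul_of_nonneg_left (Finset.sum_le_sum fun o _ => hRo o ⟨t, ht.1, rfl⟩) hCω0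
    · intro i t ht
      simp only [hy, hzeta]
      congr 1
      simp only [smul_sub, Finset.sum_sub_distrib, Finset.smul_sum, smul_smul]
      congr 1
      rw [Finset.sum_comm]
      refine Finset.sum_congr rfl fun o _ => ?_
      rw [← Finset.sum_smul, ← hMK, Matrix.mul_apply]
  · -- ungrounded case
    push Not at hgr
    have hε0 : ∀ i, ε i = 0 := fun i => le_antisymm (hgr i) (hε i)
    have hW0 : ∀ i o, W i o = 0 := fun i o =>
      (Finset.sum_eq_zero_iff_of_nonneg (fun o _ => hWnn i o)).mp (hε0 i) o (Finset.mem_univ o)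
    have hM0 : ∀ i, ∑ k, M i k = 0 := by
      intro i
      have := groundedLaplacian_sum_smul a ε (fun _ => (1 : ℝ)) i
      simpa [hε0] using this
    have hρpos : ∀ i : T, ∀ t ∈ J, 0 < ρ i t := fun i t ht => hR₀.trans_le (hlarge i t ht)
    have hwpos : ∀ t ∈ J, 0 < ∑ i : T, α i / ρ i t := fun t ht =>
      Finset.sum_pos (fun i _ => div_pos (hpos i) (hρpos i t ht)) Finset.univ_nonempty
    -- Subtracting this mean leaves the signals unchanged, as M has zero row sums, and makes the
    -- weighted sum of the errors vanish. The common drift r = Ac - c' then drops out of the energy,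
    -- so only differentiability of c matters.
    set c : ℝ → Fin n → ℝ := fun t => (∑ i : T, α i / ρ i t)⁻¹ • ∑ i : T, (α i / ρ i t) • x i t
      with hc
    have hcder : ∀ t ∈ J, ∃ d, HasDerivWithinAt c d (Set.Ici 0) t := by
      intro t ht
      have h1 : ∀ i : T, ∃ d, HasDerivWithinAt (fun t => α i / ρ i t) d (Set.Ici 0) t := fun i =>
        ⟨_, (hasDerivWithinAt_const t _ (α i)).div (hρJ i t ht) (hρpos i t ht).ne'⟩
      choose d hd using h1
      exact ⟨_, ((HasDerivWithinAt.fun_sum fun i _ => hd i).inv (hwpos t ht).ne').smul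
        (HasDerivWithinAt.fun_sum fun i _ => (hd i).smul (hxJ i t ht))⟩
    choose! d hd using hcder
    refine hgain J t₀ (fun i t => x i t - c t) (fun i => ρ i) (fun i => y i) 0
      (fun t => A *ᵥ c t - d t) 0 0 0 hJc hJ0 ht₀J (fun t ht => ht.2) ?_ (fun i => hρJ i) ?_ ?_ ?_
      ?_ ?_ hlarge
    · intro i t ht
      refine ((hxJ i t ht).sub (hd t ht)).congr_deriv ?_
      simp only [Matrix.mulVec_sub, Pi.zero_apply, Matrix.mulVec_zero]
      abel
    · intro t _
      exact hasDerivWithinAt_const t _ 0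
    · simp
    · simp
    · intro i t ht
      simp only [hy, hzeta]
      congr 1
      simp only [smul_sub, Finset.sum_sub_distrib, ← Finset.sum_smul, hW0, zero_smul,
        Finset.sum_const_zero]
      rw [← hM, hM0, zero_smul]
    · intro t ht
      right
      simp only [smul_sub, Finset.sum_sub_distrib, ← Finset.sum_smul]
      rw [hc]
      simp only
      rw [smul_inv_smul₀ (hwpos t ht).ne', sub_self]

end Network

/-! ### Convergence of the signals, global solutions and the main theorem. -/

section Convergence

variable {n m N : ℕ}

theorem exists_pos_mul_quadratic_le {ι : Type*} [Fintype ι] {X S : Matrix ι ι ℝ}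
    (hX : ∀ v : ι → ℝ, v ≠ 0 → 0 < v ⬝ᵥ (X *ᵥ v)) (hS : ∀ v : ι → ℝ, v ≠ 0 → 0 < v ⬝ᵥ (S *ᵥ v)) :
    ∃ c > 0, ∀ v : ι → ℝ, c * (v ⬝ᵥ (S *ᵥ v)) ≤ v ⬝ᵥ (X *ᵥ v) := by
  rcases isEmpty_or_nonempty ι with h | h
  · exact ⟨1, one_pos, fun v => by simp [Subsingleton.elim v 0]⟩
  · obtain ⟨c, w, hw, hwc, hmin⟩ := exists_min_rayleigh X hS
    refine ⟨c, ?_, hmin⟩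
    have h1 := hX w hw
    rw [hwc] at h1
    exact (pos_iff_pos_of_mul_pos h1).mpr (hS w hw)

/-- A nonnegative function with `f' ≤ -κ f + g'`, for `g` increasing and bounded, tends to `0`. -/
theorem tendsto_zero_of_deriv_le {f f' g g' : ℝ → ℝ} {κ Γ : ℝ} (hκ : 0 < κ)
    (hf : ∀ t, 0 ≤ t → HasDerivWithinAt f (f' t) (Set.Ici 0) t)
    (hg : ∀ t, 0 ≤ t → HasDerivWithinAt g (g' t) (Set.Ici 0) t)
    (hf0 : ∀ t, 0 ≤ t → 0 ≤ f t) (hg' : MonotoneOn g (Set.Ici 0)) (hΓ : ∀ t, 0 ≤ t → g t ≤ Γ)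
    (hle : ∀ t, 0 ≤ t → f' t ≤ -κ * f t + g' t) : Tendsto f atTop (𝓝 0) := by
  set L := sSup (g '' Set.Ici 0) with hL
  have hbdd : BddAbove (g '' Set.Ici 0) := ⟨Γ, by rintro _ ⟨t, ht, rfl⟩; exact hΓ t ht⟩
  have hgL : ∀ t, 0 ≤ t → g t ≤ L := fun t ht => le_csSup hbdd ⟨t, ht, rfl⟩
  rw [Metric.tendsto_atTop]
  intro δ hδ
  obtain ⟨_, ⟨t₁, ht₁, rfl⟩, hgt₁⟩ := exists_lt_of_lt_csSup
    (⟨g 0, 0, Set.self_mem_Ici, rfl⟩ : (g '' Set.Ici 0).Nonempty) (by linarith : L - δ / 2 < L)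
  have ht₁0 : 0 ≤ t₁ := ht₁
  -- After t₁ the remaining increase L - g is below δ/2. Adding it to f absorbs g', and subtracting
  -- δ/2 makes the leftover term κ(L - g - δ/2) nonpositive, so Z is antitone.
  set Z : ℝ → ℝ := fun t => Real.exp (κ * t) * (f t + (L - g t) - δ / 2) with hZ
  have hZder : ∀ t ∈ Set.Ici t₁, HasDerivWithinAt Z
      (Real.exp (κ * t) * (κ * 1) * (f t + (L - g t) - δ / 2) +
        Real.exp (κ * t) * (f' t + (0 - g' t))) (Set.Ici 0) t := by
    intro t ht
    have ht0 : 0 ≤ t := ht₁0.trans ht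
    refine HasDerivWithinAt.mul ?_ ?_
    · exact ((hasDerivWithinAt_id t _).const_mul κ).exp
    · exact ((hf t ht0).add ((hasDerivWithinAt_const t _ L).sub (hg t ht0))).sub_const _
  have hanti : AntitoneOn Z (Set.Ici t₁) := by
    refine antitoneOn_of_hasDerivWithinAt Set.ordConnected_Ici (Set.Ici_subset_Ici.mpr ht₁0)
      hZder fun t ht => ?_
    have ht0 : 0 ≤ t := ht₁0.trans ht
    have h1 := hle t ht0
    have h2 := hg' ht₁ ht0 ht
    have h3 : L - g t - δ / 2 ≤ 0 := by linarith
    have h4 : Real.exp (κ * t) * (κ * 1) * (f t + (L - g t) - δ / 2) +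
        Real.exp (κ * t) * (f' t + (0 - g' t)) =
        Real.exp (κ * t) * (κ * f t + f' t - g' t + κ * (L - g t - δ / 2)) := by ring
    rw [h4]
    refine mul_nonpos_of_nonneg_of_nonpos (Real.exp_pos _).le ?_
    nlinarith
  have hlim : Tendsto (fun t => Real.exp (-(κ * t)) * Z t₁) atTop (𝓝 (0 * Z t₁)) := by
    refine Tendsto.mul_const _ (Real.tendsto_exp_neg_atTop_nhds_zero.comp ?_)
    exact tendsto_id.const_mul_atTop hκ
  rw [zero_mul] at hlim
  obtain ⟨t₂, ht₂⟩ := eventually_atTop.mp (hlim.eventually_lt_const (half_pos hδ))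
  refine ⟨max t₁ t₂, fun t ht => ?_⟩
  have ht1 : t₁ ≤ t := (le_max_left _ _).trans ht
  have ht0 : 0 ≤ t := ht₁0.trans ht1
  have h1 := hanti Set.self_mem_Ici ht1 ht1
  have h2 := ht₂ t ((le_max_right _ _).trans ht)
  have h3 : f t + (L - g t) - δ / 2 = Real.exp (-(κ * t)) * Z t := by
    rw [hZ]
    simp only
    rw [← mul_assoc, ← Real.exp_add, neg_add_cancel, Real.exp_zero, one_mul]
  have h4 : Real.exp (-(κ * t)) * Z t ≤ Real.exp (-(κ * t)) * Z t₁ := by gcongr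
  rw [Real.dist_eq, sub_zero, abs_of_nonneg (hf0 t ht0)]
  have h5 := hgL t ht0
  linarith

variable {A : Matrix (Fin n) (Fin n) ℝ} {B : Matrix (Fin n) (Fin m) ℝ}
  {P : Matrix (Fin n) (Fin n) ℝ} {G : WeightedGraph N} {I : Set ℝ}
  {x : Fin N → ℝ → Fin n → ℝ} {ρ : Fin N → ℝ → ℝ}

theorem IsAdaptiveSolution.exists_abs_le (hP : IsRiccatiSolution A B P)
    (h : IsAdaptiveSolution A B P G I x ρ) (hI : I.OrdConnected) (hI0 : I ⊆ Set.Ici 0)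
    (h0 : (0 : ℝ) ∈ I) : ∃ R, 0 ≤ R ∧ ∀ i, ∀ t ∈ I, |ρ i t| ≤ R := by
  choose U hU using fun i => h.bddAbove hP hI hI0 i
  refine ⟨∑ i, (|ρ i 0| + |U i|), by positivity, fun i t ht => ?_⟩
  have h1 := hU i ⟨t, ht, rfl⟩
  have h2 := h.monotoneOn hI hI0 i h0 ht (hI0 ht)
  have h3 : |ρ i 0| + |U i| ≤ ∑ i, (|ρ i 0| + |U i|) :=
    Finset.single_le_sum (f := fun i => |ρ i 0| + |U i|) (fun i _ => by positivity)
      (Finset.mem_univ i)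
  refine le_trans (abs_le.mpr ⟨?_, ?_⟩) h3
  · linarith [neg_abs_le (ρ i 0), abs_nonneg (U i)]
  · linarith [le_abs_self (U i), abs_nonneg (ρ i 0)]

theorem dotProduct_sub_self_le {κ : Type*} [Fintype κ] (u v : κ → ℝ) :
    (u - v) ⬝ᵥ (u - v) ≤ 2 * (u ⬝ᵥ u) + 2 * (v ⬝ᵥ v) := by
  have := dotProduct_self_nonneg' (u + v)
  simp only [dotProduct_sub, sub_dotProduct, dotProduct_add, add_dotProduct] at *
  have h := dotProduct_comm u v
  linarith

/-- Bounded gains turn ∑ |y_k|² into the derivative of the bounded function ∑ ρ_k. This controls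
every non-decaying term in the derivative of ζ_iᵀPζ_i. -/
theorem IsAdaptiveSolution.tendsto_zeta (hP : IsRiccatiSolution A B P)
    (h : IsAdaptiveSolution A B P G (Set.Ici 0) x ρ) (i : Fin N) :
    Tendsto (fun t => G.zeta (fun j => x j t) i) atTop (𝓝 0) := by
  obtain ⟨R, hR0, hR⟩ := h.exists_abs_le hP Set.ordConnected_Ici subset_rfl Set.self_mem_Ici
  set ζ : Fin N → ℝ → Fin n → ℝ := fun i t => G.zeta (fun j => x j t) i with hζ
  set y : Fin N → ℝ → Fin m → ℝ := fun i t => (Bᵀ * P) *ᵥ ζ i t with hy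
  set u : ℝ → Fin m → ℝ := fun t => ∑ j, G.adj i j • (ρ j t • y j t - ρ i t • y i t) with hu
  have hζder : ∀ t, 0 ≤ t → HasDerivWithinAt (ζ i) (A *ᵥ ζ i t + B *ᵥ u t) (Set.Ici 0) t := by
    intro t ht
    have h1 := HasDerivWithinAt.fun_sum (u := Finset.univ) fun j (_ : j ∈ Finset.univ) =>
      ((h.hasDeriv_state i t ht).sub (h.hasDeriv_state j t ht)).const_smul (G.adj i j)
    refine h1.congr_deriv ?_
    simp only [hu, hy, hζ]
    have hA : A *ᵥ G.zeta (fun j => x j t) i = ∑ j, A *ᵥ (G.adj i j • (x i t - x j t)) := by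
      rw [WeightedGraph.zeta, Matrix.mulVec_sum]
    rw [hA, Matrix.mulVec_sum, ← Finset.sum_add_distrib]
    refine Finset.sum_congr rfl fun j _ => ?_
    simp only [Matrix.mulVec_smul, Matrix.mulVec_sub, smul_sub]
    abel
  obtain ⟨κ, hκ, hκP⟩ := exists_pos_mul_quadratic_le (X := (1 : Matrix (Fin n) (Fin n) ℝ)) (S := P)
    (fun v hv => by rw [Matrix.one_mulVec]; exact dotProduct_self_pos hv) (fun v hv => hP.pos hv)
  obtain ⟨l, hl, hlP⟩ := exists_pos_mul_quadratic_le (X := P) (S := (1 : Matrix (Fin n) (Fin n) ℝ))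
    (fun v hv => hP.pos hv) (fun v hv => by rw [Matrix.one_mulVec]; exact dotProduct_self_pos hv)
  simp only [Matrix.one_mulVec] at hκP hlP
  set D : ℝ → ℝ := fun t => ∑ k, y k t ⬝ᵥ y k t with hD
  have hyD : ∀ k t, y k t ⬝ᵥ y k t ≤ D t := fun k t =>
    Finset.single_le_sum (f := fun k => y k t ⬝ᵥ y k t) (fun k _ => dotProduct_self_nonneg' _)
      (Finset.mem_univ k)
  -- The 2 collects |y_i|² from the Riccati identity and from 2 y_i·u ≤ |y_i|² + |u|²; the rest
  -- bounds |u|², each difference of two terms ρ_k y_k costing 4R².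
  set C : ℝ := 2 + (∑ j, G.adj i j ^ 2) * (N * (4 * R ^ 2)) with hC
  have hC0 : 0 ≤ C := by positivity
  have huD : ∀ t, 0 ≤ t → 2 * (y i t ⬝ᵥ y i t) + u t ⬝ᵥ u t ≤ C * D t := by
    intro t ht
    have h0 := dotProduct_self_nonneg' (y i t)
    have h1 : ∀ j, (ρ j t • y j t - ρ i t • y i t) ⬝ᵥ (ρ j t • y j t - ρ i t • y i t) ≤
        4 * R ^ 2 * D t := by
      intro j
      refine (dotProduct_sub_self_le _ _).trans ?_
      have h2 : ∀ k, (ρ k t • y k t) ⬝ᵥ (ρ k t • y k t) ≤ R ^ 2 * D t := by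
        intro k
        have h3 : ρ k t ^ 2 ≤ R ^ 2 := sq_le_sq' (neg_le_of_abs_le (hR k t ht))
          (le_of_abs_le (hR k t ht))
        rw [smul_dotProduct, dotProduct_smul, smul_eq_mul, smul_eq_mul, ← mul_assoc, ← sq]
        exact mul_le_mul h3 (hyD k t) (dotProduct_self_nonneg' _) (sq_nonneg _)
      linarith [h2 i, h2 j]
    have h2 : u t ⬝ᵥ u t ≤ (∑ j, G.adj i j ^ 2) * (N * (4 * R ^ 2 * D t)) := by
      refine (sum_smul_dotProduct_self_le _ _).trans ?_
      refine mul_le_mul_of_nonneg_left ?_ (Finset.sum_nonneg fun j _ => sq_nonneg _)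
      refine (Finset.sum_le_sum fun j _ => h1 j).trans (le_of_eq ?_)
      simp
    rw [hC]
    linarith [hyD i t]
  have hW : Tendsto (fun t => ζ i t ⬝ᵥ (P *ᵥ ζ i t)) atTop (𝓝 0) := by
    refine tendsto_zero_of_deriv_le (g := fun t => C * ∑ k, ρ k t) (g' := fun t => C * D t)
      (Γ := C * ∑ _k : Fin N, R) hκ
      (fun t ht => hasDerivWithinAt_quadratic hP.transpose_eq (hζder t ht))
      (fun t ht => (HasDerivWithinAt.fun_sum fun k _ => h.hasDeriv_gain k t ht).const_mul C)
      (fun t _ => hP.nonneg _) ?_ ?_ ?_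
    · intro s hs t ht hst
      exact mul_le_mul_of_nonneg_left (Finset.sum_le_sum fun k _ =>
        h.monotoneOn Set.ordConnected_Ici subset_rfl k hs ht hst) hC0
    · intro t ht
      exact mul_le_mul_of_nonneg_left (Finset.sum_le_sum fun k _ =>
        (le_abs_self _).trans (hR k t ht)) hC0
    · intro t ht
      have h1 := hP.two_mul_quadratic (ζ i t)
      have h2 := two_mul_dotProduct_le (y i t) (u t)
      have h3 := huD t ht
      have h4 := hκP (ζ i t)
      rw [Matrix.mulVec_add, dotProduct_add, dotProduct_mulVec_input hP.transpose_eq B (ζ i t) (u t)]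
      change 2 * (ζ i t ⬝ᵥ P *ᵥ A *ᵥ ζ i t + y i t ⬝ᵥ u t) ≤ _
      change _ = -(ζ i t ⬝ᵥ ζ i t) + y i t ⬝ᵥ y i t at h1
      linarith
  have hsq : Tendsto (fun t => l⁻¹ * (ζ i t ⬝ᵥ (P *ᵥ ζ i t))) atTop (𝓝 0) := by
    simpa using hW.const_mul l⁻¹
  rw [tendsto_pi_nhds]
  intro k
  have h1 : Tendsto (fun t => ζ i t k ^ 2) atTop (𝓝 0) := by
    refine squeeze_zero (fun t => sq_nonneg _) (fun t => ?_) hsq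
    have h2 : ζ i t k ^ 2 ≤ ζ i t ⬝ᵥ ζ i t := by
      rw [sq]
      exact Finset.single_le_sum (f := fun k => ζ i t k * ζ i t k)
        (fun k _ => mul_self_nonneg _) (Finset.mem_univ k)
    rw [← div_eq_inv_mul, le_div_iff₀' hl]
    exact (mul_le_mul_of_nonneg_left h2 hl.le).trans (hlP _)
  have h2 := h1.sqrt
  simp only [Real.sqrt_sq_eq_abs, Real.sqrt_zero] at h2
  exact (tendsto_zero_iff_abs_tendsto_zero _).mpr h2

/-- The closed-loop vector field of the network under the adaptive protocol. -/
def adaptiveField (A : Matrix (Fin n) (Fin n) ℝ) (B : Matrix (Fin n) (Fin m) ℝ)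
    (P : Matrix (Fin n) (Fin n) ℝ) (G : WeightedGraph N) (z : (Fin N → Fin n → ℝ) × (Fin N → ℝ)) :
    (Fin N → Fin n → ℝ) × (Fin N → ℝ) :=
  (fun i => A *ᵥ z.1 i - z.2 i • (B *ᵥ ((Bᵀ * P) *ᵥ G.zeta z.1 i)),
    fun i => ((Bᵀ * P) *ᵥ G.zeta z.1 i) ⬝ᵥ ((Bᵀ * P) *ᵥ G.zeta z.1 i))

theorem contDiff_adaptiveField (A : Matrix (Fin n) (Fin n) ℝ) (B : Matrix (Fin n) (Fin m) ℝ)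
    (P : Matrix (Fin n) (Fin n) ℝ) (G : WeightedGraph N) : ContDiff ℝ 1 (adaptiveField A B P G) := by
  have hζ : ∀ i k, ContDiff ℝ 1
      fun z : (Fin N → Fin n → ℝ) × (Fin N → ℝ) => G.zeta z.1 i k := by
    intro i k
    simp only [WeightedGraph.zeta, Finset.sum_apply, Pi.smul_apply, Pi.sub_apply, smul_eq_mul]
    fun_prop
  refine ContDiff.prodMk ?_ ?_
  · refine contDiff_pi.mpr fun i => contDiff_pi.mpr fun k => ?_
    simp only [Pi.sub_apply, Pi.smul_apply, smul_eq_mul, Matrix.mulVec, dotProduct]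
    fun_prop
  · refine contDiff_pi.mpr fun i => ?_
    simp only [Matrix.mulVec, dotProduct]
    fun_prop

theorem hasDerivWithinAt_fst_comp {E F : Type*} [NormedAddCommGroup E] [NormedSpace ℝ E]
    [NormedAddCommGroup F] [NormedSpace ℝ F] {z : ℝ → E × F} {z' : E × F} {s : Set ℝ} {t : ℝ}
    (hz : HasDerivWithinAt z z' s t) : HasDerivWithinAt (fun t => (z t).1) z'.1 s t :=
  hz.hasFDerivWithinAt.fst.hasDerivWithinAt.congr_deriv (by simp)

theorem hasDerivWithinAt_snd_comp {E F : Type*} [NormedAddCommGroup E] [NormedSpace ℝ E]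
    [NormedAddCommGroup F] [NormedSpace ℝ F] {z : ℝ → E × F} {z' : E × F} {s : Set ℝ} {t : ℝ}
    (hz : HasDerivWithinAt z z' s t) : HasDerivWithinAt (fun t => (z t).2) z'.2 s t :=
  hz.hasFDerivWithinAt.snd.hasDerivWithinAt.congr_deriv (by simp)

theorem isAdaptiveSolution_of_forwardSolution {z₀ : (Fin N → Fin n → ℝ) × (Fin N → ℝ)}
    {z : ℝ → (Fin N → Fin n → ℝ) × (Fin N → ℝ)}
    (hz : IsForwardSolution (adaptiveField A B P G) z₀ I z) :
    IsAdaptiveSolution A B P G I (fun i t => (z t).1 i) (fun i t => (z t).2 i) := by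
  refine ⟨fun i t ht => ?_, fun i t ht => ?_⟩
  · exact hasDerivWithinAt_pi.mp (hasDerivWithinAt_fst_comp (hz.2 t ht)) i
  · exact hasDerivWithinAt_pi.mp (hasDerivWithinAt_snd_comp (hz.2 t ht)) i

theorem norm_zeta_le (G : WeightedGraph N) (x : Fin N → Fin n → ℝ) (i : Fin N) :
    ‖G.zeta x i‖ ≤ (∑ j, G.adj i j * 2) * ‖x‖ := by
  rw [Finset.sum_mul]
  refine (norm_sum_le _ _).trans (Finset.sum_le_sum fun j _ => ?_)
  rw [norm_smul, Real.norm_of_nonneg (G.adj_nonneg i j), mul_assoc]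
  refine mul_le_mul_of_nonneg_left ?_ (G.adj_nonneg i j)
  exact (norm_sub_le _ _).trans (by linarith [norm_le_pi_norm x i, norm_le_pi_norm x j])

/-- The field is quadratic and cubic, but with the gains bounded on the interval the x-part grows at
most linearly in x, and Gronwall applies. -/
theorem exists_norm_le_of_adaptiveField_solution (hP : IsRiccatiSolution A B P)
    {z₀ : (Fin N → Fin n → ℝ) × (Fin N → ℝ)} {z : ℝ → (Fin N → Fin n → ℝ) × (Fin N → ℝ)} {τ : ℝ}
    (hz : IsForwardSolution (adaptiveField A B P G) z₀ (Set.Ico 0 τ) z) :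
    ∃ R : ℝ, ∀ t ∈ Set.Ico 0 τ, ‖z t‖ ≤ R := by
  rcases le_or_gt τ 0 with hτ | hτ
  · exact ⟨0, fun t ht => absurd (ht.1.trans_lt ht.2) (not_lt.mpr hτ)⟩
  have hsol := isAdaptiveSolution_of_forwardSolution hz
  obtain ⟨R, hR0, hR⟩ := hsol.exists_abs_le hP Set.ordConnected_Ico Set.Ico_subset_Ici_self
    ⟨le_rfl, hτ⟩
  set LA := A.mulVecLin.toContinuousLinearMap
  set LB := (B * (Bᵀ * P)).mulVecLin.toContinuousLinearMap
  set c : ℝ := ∑ i, ∑ j, G.adj i j * 2 with hc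
  have hcn : ∀ i, 0 ≤ ∑ j, G.adj i j * 2 := fun i =>
    Finset.sum_nonneg fun j _ => mul_nonneg (G.adj_nonneg i j) zero_le_two
  have hci : ∀ i, ∑ j, G.adj i j * 2 ≤ c := fun i =>
    Finset.single_le_sum (f := fun i => ∑ j, G.adj i j * 2) (fun i _ => hcn i) (Finset.mem_univ i)
  have hc0 : 0 ≤ c := Finset.sum_nonneg fun i _ => hcn i
  set K : ℝ := ‖LA‖ + R * (‖LB‖ * c) with hK
  have hK0 : 0 ≤ K := by positivity
  have hbound : ∀ t ∈ Set.Ico 0 τ, ‖(adaptiveField A B P G (z t)).1‖ ≤ K * ‖(z t).1‖ + 0 := by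
    intro t ht
    rw [add_zero, pi_norm_le_iff_of_nonneg (by positivity)]
    intro i
    have h1 : ‖A *ᵥ (z t).1 i‖ ≤ ‖LA‖ * ‖(z t).1‖ :=
      (LA.le_opNorm _).trans (by gcongr; exact norm_le_pi_norm _ i)
    have h2 : ‖B *ᵥ ((Bᵀ * P) *ᵥ G.zeta (z t).1 i)‖ ≤ ‖LB‖ * (c * ‖(z t).1‖) := by
      rw [Matrix.mulVec_mulVec]
      refine (LB.le_opNorm _).trans ?_
      gcongr
      exact (norm_zeta_le G _ i).trans (by gcongr; exact hci i)
    change ‖A *ᵥ (z t).1 i - (z t).2 i • (B *ᵥ ((Bᵀ * P) *ᵥ G.zeta (z t).1 i))‖ ≤ _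
    refine (norm_sub_le _ _).trans ?_
    rw [norm_smul, Real.norm_eq_abs]
    have h3 := mul_le_mul (hR i t ht) h2 (norm_nonneg _) hR0
    rw [hK]
    linarith
  refine ⟨max (‖z₀.1‖ * Real.exp (K * τ)) R, fun t ht => ?_⟩
  rw [Prod.norm_def]
  refine max_le_max ?_ ((pi_norm_le_iff_of_nonneg hR0).mpr fun i => hR i t ht)
  have hsub : Set.Icc 0 t ⊆ Set.Ico 0 τ := fun u hu => ⟨hu.1, lt_of_le_of_lt hu.2 ht.2⟩
  have hder : ∀ u ∈ Set.Ico 0 τ, HasDerivWithinAt (fun t => (z t).1)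
      (adaptiveField A B P G (z u)).1 (Set.Ici 0) u := fun u hu =>
    hasDerivWithinAt_fst_comp (hz.2 u hu)
  have hgr := norm_le_gronwallBound_of_norm_deriv_right_le (f := fun t => (z t).1)
    (f' := fun t => (adaptiveField A B P G (z t)).1) (δ := ‖z₀.1‖) (K := K) (ε := 0) (a := 0) (b := t)
    (fun u hu => (hder u (hsub hu)).continuousWithinAt.mono fun w hw => hw.1)
    (fun u hu => (hder u (hsub ⟨hu.1, hu.2.le⟩)).mono (Set.Ici_subset_Ici.mpr hu.1))
    (by rw [hz.1]) (fun u hu => hbound u (hsub ⟨hu.1, hu.2.le⟩)) t ⟨ht.1, le_rfl⟩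
  rw [gronwallBound_ε0, sub_zero] at hgr
  refine hgr.trans ?_
  gcongr
  exact ht.2.le

theorem adaptiveProtocol_f_apply (hP : Pᵀ = P) (ξ : Fin 1 → ℝ) (ζ : Fin n → ℝ) :
    (adaptiveProtocol B P).f ξ ζ = fun _ => ((Bᵀ * P) *ᵥ ζ) ⬝ᵥ ((Bᵀ * P) *ᵥ ζ) := by
  funext _
  change ζ ⬝ᵥ ((P * B * Bᵀ * P) *ᵥ ζ) = _
  rw [← dotProduct_transpose_mulVec, Matrix.transpose_mul, Matrix.transpose_transpose, hP,
    Matrix.mulVec_mulVec, Matrix.mul_assoc (P * B)]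

theorem mulVec_adaptiveProtocol_g (ξ : Fin 1 → ℝ) (ζ v : Fin n → ℝ) :
    A *ᵥ v + B *ᵥ (adaptiveProtocol B P).g ξ ζ =
      A *ᵥ v - ξ 0 • (B *ᵥ ((Bᵀ * P) *ᵥ ζ)) := by
  change A *ᵥ v + B *ᵥ (-(ξ 0 • ((Bᵀ * P) *ᵥ ζ))) = _
  rw [Matrix.mulVec_neg, Matrix.mulVec_smul, sub_eq_add_neg]

theorem IsRiccatiSolution.scaleFreeWeakSync (hP : IsRiccatiSolution A B P) :
    ScaleFreeWeakSync A B (adaptiveProtocol B P) := by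
  intro N G x₀ ξ₀
  refine ⟨?_, fun x ξ hsol _ _ i => ?_⟩
  · obtain ⟨z, hz⟩ := exists_global_forwardSolution (contDiff_adaptiveField A B P G)
      (x₀, fun i => ξ₀ i (0 : Fin 1)) fun τ z hz => exists_norm_le_of_adaptiveField_solution hP hz
    have hsol := isAdaptiveSolution_of_forwardSolution hz
    refine ⟨fun i t => (z t).1 i, fun i t _ => (z t).2 i, fun i t ht => ⟨?_, ?_⟩, fun i => ?_,
      fun i => ?_⟩
    · exact (hsol.hasDeriv_state i t ht).congr_deriv
        (mulVec_adaptiveProtocol_g (fun _ => (z t).2 i) _ _).symm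
    · refine hasDerivWithinAt_pi.mpr fun k => (hsol.hasDeriv_gain i t ht).congr_deriv ?_
      exact (congrFun (adaptiveProtocol_f_apply hP.transpose_eq (fun _ => (z t).2 i) _) k).symm
    · simp only [hz.1]
    · funext k
      simp only [hz.1]
      rw [Subsingleton.elim (α := Fin 1) k 0]
  · have hsol' : IsAdaptiveSolution A B P G (Set.Ici 0) x (fun i t => ξ i t (0 : Fin 1)) := by
      refine ⟨fun i t ht => ?_, fun i t ht => ?_⟩
      · exact (hsol i t ht).1.congr_deriv (mulVec_adaptiveProtocol_g (ξ i t) _ _)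
      · exact (hasDerivWithinAt_pi.mp (hsol i t ht).2 (0 : Fin 1)).congr_deriv
          (congrFun (adaptiveProtocol_f_apply hP.transpose_eq (ξ i t) _) (0 : Fin 1))
    exact hsol'.tendsto_zeta hP i

end Convergence

theorem theorem1 {n m : ℕ} (A : Matrix (Fin n) (Fin n) ℝ) (B : Matrix (Fin n) (Fin m) ℝ)
    (hAB : Stabilizable A B) :
    (∃ K : Protocol n m, ScaleFreeWeakSync A B K) ∧
    (∃ P : Matrix (Fin n) (Fin n) ℝ, IsRiccatiSolution A B P) ∧
    (∀ P : Matrix (Fin n) (Fin n) ℝ, IsRiccatiSolution A B P →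
      ScaleFreeWeakSync A B (adaptiveProtocol B P)) := by
  obtain ⟨P, hP⟩ := hAB.exists_isRiccatiSolution
  exact ⟨⟨_, hP.scaleFreeWeakSync⟩, ⟨P, hP⟩, fun _ hP' => hP'.scaleFreeWeakSync⟩
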